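/- Let $F$ be a number field, $v$ a place of $F$ (finite or infinite) and $F_v$ the completion. For a field $k$, let $K^{MW}_*(k)$ be the Milnor–Witt K-theory ring: the graded ring generated by symbols $[a]$, $a\in k^\times$, of degree $1$, and $\eta$ of degree $-1$, with relations $[a][1-a]=0$ (for $a\neq 1$), $[ab]=[a]+[b]+\eta[a][b]$, $\eta[a]=[a]\eta$ and $(2+\eta[-1])\eta=0$. Let $p\colon K_1^{MW}(F_v)\to F_v^\times$ be the homomorphism that kills $\eta$ and sends $[a]$ to $a$. Embed $F_v^{\times 2}$ (with the subspace topology from $F_v^\times$) into $K_1^{MW}(F_v)$ by $b^2\mapsto(2+\eta[-1])[b]=[b^2]$, and give $K_1^{MW}(F_v)$ the topology in which a set is open iff its intersection with every coset of $F_v^{\times 2}$ is open, each coset being topologized as a translate of $F_v^{\times2}$. For $v$ finite, with valuation ring $\mathcal O_v$, maximal ideal $\mathfrak m_v$ and residue field $k(v)$, let $K_1^{MW}(\mathcal O_v)$ be the kernel on $K_1^{MW}(F_v)$ of the residue map $\partial_v\colon K_1^{MW}(F_v)\to K_0^{MW}(k(v),(\mathfrak m_v/\mathfrak m_v^2)^\vee)$,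 the target being identified with the twisted Grothendieck–Witt group $GW(k(v),(\mathfrak m_v/\mathfrak m_v^2)^\vee)$. **Proposition 3.1.** For every place $v$ of $F$, $K_1^{MW}(F_v)$ is a topological group and $p\colon K_1^{MW}(F_v)\to F_v^\times$ is a covering of topological groups, i.e. a surjective homomorphism of topological groups that is a covering map. If moreover $v$ is finite, then: 1. $p$ is proper, and it is two-sheeted (every fibre has exactly two elements); 2. $K_1^{MW}(F_v)$ is locally compact and totally disconnected, and $K_1^{MW}(\mathcal O_v)$ is a compact subset of $K_1^{MW}(F_v)$. -/

import Mathlib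

open NumberField IsDedekindDomain

namespace MilnorWitt

/-! ### Milnor–Witt K-theory of a field -/

/-- The generators of Milnor–Witt K-theory: a symbol for each unit (degree `1`), and `η`
(degree `-1`). -/
inductive Gen (F : Type*) [Field F] : Type _
  | symb (a : Fˣ) : Gen F
  | eta : Gen F

open FreeAlgebra in
/-- The relations of Milnor–Witt K-theory. In `steinberg`, `b` is `1 - a` (a unit, so `a ≠ 1`). -/
inductive Rel (F : Type*) [Field F] : FreeAlgebra ℤ (Gen F) → FreeAlgebra ℤ (Gen F) → Prop
  | steinberg (a b : Fˣ) (h : (b : F) = 1 - (a : F)) :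
      Rel F (ι ℤ (Gen.symb a) * ι ℤ (Gen.symb b)) 0
  | mul (a b : Fˣ) :
      Rel F (ι ℤ (Gen.symb (a * b)))
        (ι ℤ (Gen.symb a) + ι ℤ (Gen.symb b)
          + ι ℤ Gen.eta * ι ℤ (Gen.symb a) * ι ℤ (Gen.symb b))
  | eta_comm (a : Fˣ) :
      Rel F (ι ℤ Gen.eta * ι ℤ (Gen.symb a)) (ι ℤ (Gen.symb a) * ι ℤ Gen.eta)
  | eta_hyp :
      Rel F ((2 + ι ℤ Gen.eta * ι ℤ (Gen.symb (-1))) * ι ℤ Gen.eta) 0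

/-- The Milnor–Witt K-theory ring `K_*^MW(F)`: the associative `ℤ`-algebra with generators `Gen F`
and relations `Rel F`. -/
def KMW (F : Type*) [Field F] : Type _ := RingQuot (Rel F)

noncomputable instance (F : Type*) [Field F] : Ring (KMW F) :=
  inferInstanceAs (Ring (RingQuot (Rel F)))

section Ring

variable {F : Type*} [Field F]

/-- The symbol `[a]`. -/
noncomputable def symb (a : Fˣ) : KMW F :=
  RingQuot.mkRingHom (Rel F) (FreeAlgebra.ι ℤ (Gen.symb a))

/-- The element `η`. -/
noncomputable def eta (F : Type*) [Field F] : KMW F :=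
  RingQuot.mkRingHom (Rel F) (FreeAlgebra.ι ℤ Gen.eta)

/-- `⟨a⟩ = 1 + η[a]`. -/
noncomputable def angle (a : Fˣ) : KMW F := 1 + eta F * symb a

/-- The hyperbolic element `h = 2 + η[-1]`. -/
noncomputable def hyp (F : Type*) [Field F] : KMW F := 2 + eta F * symb (-1)

theorem symb_mul_symb_eq_zero (a b : Fˣ) (h : (b : F) = 1 - (a : F)) : symb a * symb b = 0 := by
  have key := RingQuot.mkRingHom_rel (Rel.steinberg a b h)
  simp only [map_mul, map_zero] at key
  exact key

theorem symb_mul (a b : Fˣ) :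
    symb (a * b) = symb a + symb b + eta F * symb a * symb b := by
  have key := RingQuot.mkRingHom_rel (Rel.mul a b)
  simp only [map_mul, map_add] at key
  exact key

theorem eta_mul_symb (a : Fˣ) : eta F * symb a = symb a * eta F := by
  have key := RingQuot.mkRingHom_rel (Rel.eta_comm a)
  simp only [map_mul] at key
  exact key

theorem hyp_mul_eta : hyp F * eta F = 0 := by
  have key := RingQuot.mkRingHom_rel (Rel.eta_hyp (F := F))
  simp only [map_mul, map_add, map_zero, map_ofNat] at key
  exact key

/-- The universal property of `K_*^MW(F)`. -/
noncomputable def lift {A : Type*} [Ring A] (s : Fˣ → A) (e : A)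
    (h1 : ∀ a b : Fˣ, (b : F) = 1 - (a : F) → s a * s b = 0)
    (h2 : ∀ a b : Fˣ, s (a * b) = s a + s b + e * s a * s b)
    (h3 : ∀ a : Fˣ, e * s a = s a * e)
    (h4 : (2 + e * s (-1)) * e = 0) : KMW F →+* A :=
  RingQuot.lift
    ⟨(FreeAlgebra.lift ℤ (fun g : Gen F => Gen.rec s e g)).toRingHom, by
      intro x y hxy
      cases hxy with
      | steinberg a b h => simpa using h1 a b h
      | mul a b => simpa using h2 a b
      | eta_comm a => simpa using h3 a
      | eta_hyp => simpa [map_ofNat] using h4⟩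

section lift

variable {A : Type*} [Ring A] (s : Fˣ → A) (e : A)
    (h1 : ∀ a b : Fˣ, (b : F) = 1 - (a : F) → s a * s b = 0)
    (h2 : ∀ a b : Fˣ, s (a * b) = s a + s b + e * s a * s b)
    (h3 : ∀ a : Fˣ, e * s a = s a * e)
    (h4 : (2 + e * s (-1)) * e = 0)

@[simp] theorem lift_symb (a : Fˣ) : lift s e h1 h2 h3 h4 (symb a) = s a := by
  unfold lift symb
  erw [RingQuot.lift_mkRingHom_apply]
  simp

@[simp] theorem lift_eta : lift s e h1 h2 h3 h4 (eta F) = e := by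
  unfold lift eta
  erw [RingQuot.lift_mkRingHom_apply]
  simp

end lift

end Ring

/-- The degree `n` part `K_n^MW(F)` of `K_*^MW(F)`: the additive span of the monomials of degree `n`
in the generators (as `η` is central, it is collected in front). -/
noncomputable def degreePart (F : Type*) [Field F] (n : ℤ) : AddSubgroup (KMW F) :=
  AddSubgroup.closure
    {x | ∃ (m : ℕ) (l : List Fˣ), (l.length : ℤ) - m = n ∧ x = eta F ^ m * (l.map symb).prod}

/-- The first Milnor–Witt K-group `K_1^MW(F)`. -/
def K1 (F : Type*) [Field F] : Type _ := degreePart F 1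

noncomputable instance (F : Type*) [Field F] : AddCommGroup (K1 F) :=
  inferInstanceAs (AddCommGroup (degreePart F 1))

/-- The inclusion of `K_1^MW(F)` into `K_*^MW(F)`. -/
noncomputable def K1.incl (F : Type*) [Field F] : K1 F →+ KMW F := (degreePart F 1).subtype

/-- The symbol `[a]` as an element of `K_1^MW(F)`. -/
noncomputable def K1.symb {F : Type*} [Field F] (a : Fˣ) : K1 F :=
  ⟨MilnorWitt.symb a, AddSubgroup.subset_closure ⟨0, [a], by simp, by simp⟩⟩

/-! ### The projection to Milnor K-theory in degree one -/

section Milnor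

variable {F : Type*} [Field F]

/-- Multiplication by `{a}` on Milnor K-theory `K_0^M ⊕ K_1^M = ℤ ⊕ Fˣ` truncated above degree `1`:
it sends `(n, x)` to `(0, n • {a})`. -/
noncomputable def truncSymb (a : Fˣ) : AddMonoid.End (ℤ × Additive Fˣ) :=
  AddMonoidHom.mk' (fun x => ((0 : ℤ), x.1 • Additive.ofMul a)) (by
    intro x y
    ext
    · simp
    · exact congrArg (fun t : Additive Fˣ => (t.toMul : F)) (add_zsmul _ x.1 y.1))

theorem truncSymb_apply (a : Fˣ) (x : ℤ × Additive Fˣ) :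
    truncSymb a x = ((0 : ℤ), x.1 • Additive.ofMul a) := rfl

theorem truncSymb_mul_truncSymb (a b : Fˣ) :
    (truncSymb a * truncSymb b : AddMonoid.End (ℤ × Additive Fˣ)) = 0 := by
  refine AddMonoidHom.ext fun x => ?_
  change truncSymb a (truncSymb b x) = 0
  simp only [truncSymb_apply, zero_smul, Prod.mk_zero_zero]

theorem truncSymb_mul (a b : Fˣ) :
    (truncSymb (a * b) : AddMonoid.End (ℤ × Additive Fˣ)) = truncSymb a + truncSymb b := by
  refine AddMonoidHom.ext fun x => ?_
  change truncSymb (a * b) x = truncSymb a x + truncSymb b x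
  rw [truncSymb_apply, truncSymb_apply, truncSymb_apply, Prod.mk_add_mk, add_zero]
  exact congrArg (Prod.mk 0) (zsmul_add (Additive.ofMul a) (Additive.ofMul b) x.1)

/-- The ring homomorphism from `K_*^MW(F)` to Milnor K-theory truncated above degree `1` that
kills `η` and maps `[a]` to `{a}`; the target is represented by its multiplication action on
`K_0^M ⊕ K_1^M = ℤ ⊕ Fˣ`. -/
noncomputable def toMilnorTrunc (F : Type*) [Field F] :
    KMW F →+* AddMonoid.End (ℤ × Additive Fˣ) :=
  lift (F := F) truncSymb 0
    (fun a b _ => truncSymb_mul_truncSymb a b)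
    (fun a b => (truncSymb_mul a b).trans
      ((add_zero (truncSymb a + truncSymb b)).symm.trans (by rw [zero_mul, zero_mul])))
    (fun a => by rw [zero_mul, mul_zero])
    (by rw [mul_zero])

theorem toMilnorTrunc_symb (a : Fˣ) : toMilnorTrunc F (symb a) = truncSymb a := by
  exact lift_symb ..

/-- The projection `p : K_1^MW(F) → K_1^M(F) = Fˣ` given by killing `η`; it sends `[a]` to `a`. -/
noncomputable def p (F : Type*) [Field F] : K1 F →+ Additive Fˣ :=
  AddMonoidHom.mk' (fun x => (toMilnorTrunc F (K1.incl F x) (1, 0)).2) (by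
    intro x y
    rw [map_add, map_add]
    rfl)

theorem p_symb (a : Fˣ) : p F (K1.symb a) = Additive.ofMul a := by
  change (toMilnorTrunc F (symb a) (1, 0)).2 = _
  rw [toMilnorTrunc_symb, truncSymb_apply, one_smul]

end Milnor

/-! ### The topology on `K_1^MW` -/

section Topology

/-- The subgroup `F^{×2}` of squares of units. -/
def unitSquares (F : Type*) [Field F] : Subgroup Fˣ := (powMonoidHom 2).range

/-- The embedding `F^{×2} → K_1^MW(F)`, `b ^ 2 ↦ h[b] = [b ^ 2]`; see `hyp_mul_symb`. -/
noncomputable def ofSquare {F : Type*} [Field F] (c : unitSquares F) : K1 F := K1.symb (c : Fˣ)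

/-- The topology on an abelian group `G` extending that of a topological group `H` along
`i : H → G`: a set is open iff its intersection with each coset `g + i(H)` is open, where the coset
carries the topology of `H` via `x ↦ g + i x`. (Translations of `H` are homeomorphisms, so this does
not depend on the representatives `g` of the cosets, and all of them are used here.) -/
@[reducible] def cosetTopology {G H : Type*} [AddCommGroup G] [TopologicalSpace H] (i : H → G) :
    TopologicalSpace G :=
  ⨆ g : G, TopologicalSpace.coinduced (fun x : H => g + i x) inferInstance

noncomputable instance (F : Type*) [Field F] [TopologicalSpace F] : TopologicalSpace (K1 F) :=
  cosetTopology (ofSquare (F := F))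

end Topology

/-! ### Identities in the Milnor–Witt ring -/

section Identities

variable {F : Type*} [Field F]

theorem eta_mul_symb_mul_symb_comm (a b : Fˣ) :
    eta F * symb a * symb b = eta F * symb b * symb a := by
  have h1 := symb_mul a b
  have h2 := symb_mul b a
  rw [mul_comm b a, h1, add_comm (symb b)] at h2
  exact add_left_cancel h2

theorem symb_one : symb (1 : Fˣ) = 0 := by
  have hneg : symb (1 : Fˣ) = hyp F * symb (-1) := by
    have h := symb_mul (-1 : Fˣ) (-1)
    rw [neg_mul_neg, one_mul] at h
    rw [h, hyp]; noncomm_ring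
  have he : eta F * symb (1 : Fˣ) = 0 := by
    rw [eta_mul_symb, hneg, mul_assoc, ← eta_mul_symb, ← mul_assoc, hyp_mul_eta, zero_mul]
  have h := symb_mul (1 : Fˣ) 1
  rw [one_mul, he, zero_mul, add_zero] at h
  simpa using h

theorem angle_one : angle (1 : Fˣ) = 1 := by simp [angle, symb_one]

theorem angle_mul (a b : Fˣ) : angle (a * b) = angle a * angle b := by
  simp only [angle, symb_mul, mul_add, add_mul, mul_one, one_mul]
  rw [mul_assoc (eta F) (symb a) (eta F * symb b), ← mul_assoc (symb a), ← eta_mul_symb a]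
  simp only [add_assoc]

theorem symb_mul_eq (a b : Fˣ) : symb (a * b) = symb a + angle a * symb b := by
  rw [symb_mul, angle]; noncomm_ring

theorem angle_mul_symb (a b : Fˣ) : angle a * symb b = symb b * angle a := by
  rw [angle, add_mul, mul_add, one_mul, mul_one, eta_mul_symb_mul_symb_comm, eta_mul_symb b,
    mul_assoc]

theorem angle_mul_eta (a : Fˣ) : angle a * eta F = eta F * angle a := by
  rw [angle, add_mul, mul_add, one_mul, mul_one, mul_assoc, eta_mul_symb]

theorem angle_mul_angle (a b : Fˣ) : angle a * angle b = angle b * angle a := by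
  rw [← angle_mul, mul_comm, angle_mul]

theorem hyp_eq : hyp F = 1 + angle (-1) := by
  rw [hyp, angle, ← add_assoc, one_add_one_eq_two]

theorem hyp_mul_angle (a : Fˣ) : hyp F * angle a = hyp F := by
  rw [angle, mul_add, ← mul_assoc, hyp_mul_eta, zero_mul, mul_one, add_zero]

theorem angle_mul_hyp (a : Fˣ) : angle a * hyp F = hyp F := by
  rw [hyp_eq, mul_add, angle_mul_angle, mul_one]
  have := hyp_mul_angle a
  rwa [hyp_eq, add_mul, one_mul] at this

theorem hyp_mul_symb_neg_one : hyp F * symb (-1) = 0 := by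
  have h := symb_mul (-1 : Fˣ) (-1)
  rw [neg_mul_neg, one_mul, symb_one] at h
  rw [h, hyp]; noncomm_ring

theorem symb_inv (a : Fˣ) : symb a⁻¹ = -(angle a⁻¹ * symb a) := by
  have h := symb_mul_eq a⁻¹ a
  rw [inv_mul_cancel, symb_one] at h
  exact eq_neg_of_add_eq_zero_left h.symm

theorem symb_mul_symb_neg (a : Fˣ) : symb a * symb (-a) = 0 := by
  by_cases ha : a = 1
  · simp [ha, symb_one]
  have ha0 : (a : F) ≠ 0 := a.ne_zero
  have ha1 : (1 : F) - a ≠ 0 := by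
    rw [sub_ne_zero]; exact fun h => ha (Units.ext h.symm)
  have ha2 : (1 : F) - ((a⁻¹ : Fˣ) : F) ≠ 0 := by
    rw [sub_ne_zero]; exact fun h => ha (inv_eq_one.mp (Units.ext h.symm))
  set b : Fˣ := Units.mk0 _ ha1 with hb
  set c : Fˣ := Units.mk0 _ ha2 with hc
  have hbc : b = -a * c := by
    ext
    simp only [hb, hc, Units.val_mk0, Units.val_mul, Units.val_neg, Units.val_inv_eq_inv_val]
    field_simp
    ring
  have h1 : symb a * symb b = 0 := symb_mul_symb_eq_zero a b rfl
  have h2 : symb a⁻¹ * symb c = 0 := symb_mul_symb_eq_zero a⁻¹ c rfl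
  have h3 : symb a * symb c = 0 := by
    have ha' : symb a = -(angle a * symb a⁻¹) := by
      have := symb_inv a⁻¹
      rwa [inv_inv] at this
    rw [ha', neg_mul, mul_assoc, h2, mul_zero, neg_zero]
  rw [hbc, symb_mul_eq, mul_add, ← mul_assoc, ← angle_mul_symb, mul_assoc, h3, mul_zero,
    add_zero] at h1
  exact h1

theorem symb_mul_symb_self (a : Fˣ) : symb a * symb a = symb a * symb (-1) := by
  have h1 := symb_mul_symb_neg a
  have h2 := symb_mul_eq (-1) a
  rw [neg_one_mul] at h2
  rw [h2, mul_add, ← mul_assoc, ← angle_mul_symb, mul_assoc] at h1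
  have h3 : angle (-1 : Fˣ) * angle (-1) = 1 := by
    rw [← angle_mul, neg_mul_neg, one_mul, angle_one]
  have h4 : angle (-1 : Fˣ) * symb (-1) = -symb (-1) := by
    have h := hyp_mul_symb_neg_one (F := F)
    rw [hyp_eq, add_mul, one_mul] at h
    exact eq_neg_of_add_eq_zero_right h
  have h5 := congrArg (fun x => angle (-1 : Fˣ) * x) h1
  simp only [mul_add, mul_zero] at h5
  rw [← mul_assoc, ← mul_assoc (angle _) (angle _), h3, one_mul, angle_mul_symb, mul_assoc, h4,
    mul_neg] at h5
  exact (eq_of_sub_eq_zero (by rw [← h5]; abel))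

/-- The compatibility `h[b] = [b ^ 2]`. -/
theorem hyp_mul_symb (b : Fˣ) : hyp F * symb b = symb (b ^ 2) := by
  rw [pow_two, symb_mul, mul_assoc, symb_mul_symb_self, ← mul_assoc,
    eta_mul_symb_mul_symb_comm b, hyp]
  noncomm_ring

/-- `ε = -⟨-1⟩`. -/
noncomputable def eps (F : Type*) [Field F] : KMW F := -angle (-1)

theorem eps_mul_symb (a : Fˣ) : eps F * symb a = symb a * eps F := by
  simp [eps, angle_mul_symb]

theorem eta_mul_eps : eta F * eps F = eta F := by
  have h := hyp_mul_eta (F := F)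
  rw [hyp_eq, add_mul, one_mul, angle_mul_eta] at h
  rw [eps, mul_neg]
  exact (eq_neg_of_add_eq_zero_left h).symm

theorem eps_mul_eta : eps F * eta F = eta F := by
  rw [eps, neg_mul, angle_mul_eta, ← mul_neg]
  exact eta_mul_eps

theorem eps_mul_symb_eq (a : Fˣ) : eps F * symb a = symb (-1) - symb (-a) := by
  have := symb_mul_eq (-1) a
  rw [neg_one_mul] at this
  rw [this, eps]; noncomm_ring

/-- The element `n_ε` of `K_0^MW(F)`, namely `∑_{i=1}^n ⟨(-1)^{i-1}⟩` for `n ≥ 0` and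
`ε (-n)_ε` for `n < 0`; explicitly, `(2k)_ε = k h` and `(2k+1)_ε = k h + 1`. -/
noncomputable def nEps (F : Type*) [Field F] (n : ℤ) : KMW F :=
  (n / 2) • hyp F + ((n % 2 : ℤ) : KMW F)

theorem nEps_even (k : ℤ) : nEps F (k + k) = k • hyp F := by
  have h1 : (k + k) / 2 = k := by omega
  have h2 : (k + k) % 2 = 0 := by omega
  rw [nEps, h1, h2, Int.cast_zero, add_zero]

theorem nEps_odd (k : ℤ) : nEps F (2 * k + 1) = k • hyp F + 1 := by
  have h1 : (2 * k + 1) / 2 = k := by omega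
  have h2 : (2 * k + 1) % 2 = 1 := by omega
  rw [nEps, h1, h2, Int.cast_one]

theorem nEps_zero : nEps F 0 = 0 := by
  simpa using nEps_even (F := F) 0

theorem nEps_add (n m : ℤ) :
    nEps F (n + m) = nEps F n + angle ((-1 : Fˣ) ^ n) * nEps F m := by
  rcases Int.even_or_odd' m with ⟨l, rfl | rfl⟩ <;> rcases Int.even_or_odd' n with ⟨k, rfl | rfl⟩
  · rw [two_mul, two_mul, Even.neg_one_zpow ⟨k, rfl⟩, angle_one, one_mul,
      show k + k + (l + l) = (k + l) + (k + l) by ring, nEps_even, nEps_even, nEps_even, add_smul]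
  · rw [Odd.neg_one_zpow ⟨k, rfl⟩, show 2 * k + 1 + 2 * l = 2 * (k + l) + 1 by ring, two_mul l,
      nEps_even, nEps_odd, nEps_odd, mul_smul_comm, angle_mul_hyp, add_smul]
    abel
  · rw [Even.neg_one_zpow ⟨k, two_mul k⟩, angle_one, one_mul, two_mul k,
      show k + k + (2 * l + 1) = 2 * (k + l) + 1 by ring, nEps_even, nEps_odd, nEps_odd, add_smul]
    abel
  · rw [Odd.neg_one_zpow ⟨k, rfl⟩,
      show 2 * k + 1 + (2 * l + 1) = (k + l + 1) + (k + l + 1) by ring,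
      nEps_even, nEps_odd, nEps_odd, mul_add, mul_smul_comm, angle_mul_hyp, mul_one,
      add_smul, add_smul, one_smul]
    nth_rw 3 [hyp_eq]
    abel

theorem hyp_mul_symb_comm (a : Fˣ) : hyp F * symb a = symb a * hyp F := by
  rw [hyp_eq, mul_add, add_mul, angle_mul_symb, mul_one, one_mul]

theorem eta_mul_nEps (n : ℤ) : eta F * nEps F n = nEps F n * eta F := by
  have h : eta F * hyp F = 0 := by
    rw [← hyp_mul_eta, hyp_eq, mul_add, add_mul, angle_mul_eta, mul_one, one_mul]
  rw [nEps, mul_add, add_mul, mul_smul_comm, smul_mul_assoc, h, hyp_mul_eta, Int.cast_comm]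

theorem angle_mul_nEps (a : Fˣ) (n : ℤ) : angle a * nEps F n = nEps F n * angle a := by
  rw [nEps, mul_add, add_mul, mul_smul_comm, smul_mul_assoc, angle_mul_hyp, hyp_mul_angle,
    Int.cast_comm]

theorem eps_mul_hyp : eps F * hyp F = -hyp F := by
  rw [eps, neg_mul, angle_mul_hyp]

end Identities

/-! ### The residue map -/

section Residue

open IsLocalRing

variable {k : Type*} [Field k]

/-- The image of `u π ^ n` under the ring homomorphism `residueHom` below. -/
noncomputable def residueMatrix (n : ℤ) (u : kˣ) : Matrix (Fin 2) (Fin 2) (KMW k) :=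
  !![symb u, 0; nEps k n * angle u, eps k * symb ((-1) ^ n * u)]

theorem residueMatrix_mul (n m : ℤ) (u v : kˣ) :
    residueMatrix (n + m) (u * v) = residueMatrix n u + residueMatrix m v
      + !![eta k, 0; 0, eta k] * residueMatrix n u * residueMatrix m v := by
  have hA : eta k * (nEps k n * angle u) * symb v = nEps k n * angle u * (angle v - 1) := by
    rw [← mul_assoc, eta_mul_nEps, mul_assoc (nEps k n), ← angle_mul_eta, angle, angle]
    noncomm_ring
  have hB (w : kˣ) : eta k * (eps k * symb w) = angle w - 1 := by
    rw [← mul_assoc, eta_mul_eps, angle, add_sub_cancel_left]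
  have e1 : nEps k (n + m) * angle (u * v) = nEps k n * angle u + nEps k m * angle v
      + (eta k * (nEps k n * angle u) * symb v
        + eta k * (eps k * symb ((-1) ^ n * u)) * (nEps k m * angle v)) := by
    have hC : angle ((-1 : kˣ) ^ n) * angle u * (nEps k m * angle v)
        = angle ((-1 : kˣ) ^ n) * nEps k m * (angle u * angle v) := by
      rw [mul_assoc, ← mul_assoc (angle u), angle_mul_nEps]
      simp only [mul_assoc]
    rw [hA, hB, nEps_add, angle_mul, angle_mul, sub_mul, hC]
    noncomm_ring
  have e2 : eps k * symb ((-1) ^ (n + m) * (u * v)) = eps k * symb ((-1) ^ n * u)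
      + eps k * symb ((-1) ^ m * v)
      + eta k * (eps k * symb ((-1) ^ n * u)) * (eps k * symb ((-1) ^ m * v)) := by
    have hC : (-1 : kˣ) ^ (n + m) * (u * v) = (-1) ^ n * u * ((-1) ^ m * v) := by
      rw [zpow_add]; exact mul_mul_mul_comm _ _ _ _
    have hD (a b : kˣ) : eta k * (eps k * symb a) * (eps k * symb b)
        = eps k * (eta k * symb a * symb b) := by
      rw [← mul_assoc (eta k) (eps k), eta_mul_eps, ← mul_assoc (eps k), ← mul_assoc (eps k),
        eps_mul_eta, mul_assoc (eta k), ← mul_assoc (symb a), ← eps_mul_symb, ← mul_assoc,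
        ← mul_assoc, eta_mul_eps]
    rw [hC, symb_mul, hD]
    noncomm_ring
  simp only [residueMatrix, Matrix.mul_fin_two, e1, e2, symb_mul u v]
  ext i j; fin_cases i <;> fin_cases j <;> simp

theorem residueMatrix_mul_neg (n : ℤ) (u : kˣ) :
    residueMatrix n u * residueMatrix n (-u) = 0 := by
  have e1 : nEps k n * angle u * symb (-u) + eps k * symb ((-1) ^ n * u) * (nEps k n * angle (-u))
      = 0 := by
    have h1 : hyp k * symb (-u) = hyp k * symb u := by
      have := symb_mul_eq (-1) u
      rw [neg_one_mul] at this
      rw [this, mul_add, hyp_mul_symb_neg_one, ← mul_assoc, hyp_mul_angle, zero_add]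
    have h2 (w : kˣ) : eps k * symb w * hyp k = -(hyp k * symb w) := by
      rw [mul_assoc, ← hyp_mul_symb_comm, ← mul_assoc, eps_mul_hyp, neg_mul]
    rcases Int.even_or_odd' n with ⟨l, rfl | rfl⟩
    · rw [two_mul, Even.neg_one_zpow ⟨l, rfl⟩, one_mul, nEps_even, smul_mul_assoc, hyp_mul_angle,
        smul_mul_assoc, h1, smul_mul_assoc, hyp_mul_angle, mul_smul_comm, h2, smul_neg,
        add_neg_cancel]
    · have h3 : angle u * symb (-u) = symb (u * -u) - symb u := by
        rw [symb_mul_eq]; abel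
      have h4 : eps k * symb (-u) * angle (-u) = symb (-u) * 0 + (symb u - symb (-u))
          - (symb (u * -u) - symb (-u)) := by
        have h5 : angle (-u) * symb (-1) = symb u - symb (-u) := by
          have := symb_mul_eq (-u) (-1)
          rw [mul_neg_one, neg_neg] at this
          rw [this]; abel
        have h6 : angle (-u) * symb u = symb (u * -u) - symb (-u) := by
          have := symb_mul_eq (-u) u
          rw [mul_comm] at this
          rw [this]; abel
        rw [eps_mul_symb_eq, neg_neg, sub_mul, ← angle_mul_symb, ← angle_mul_symb, h5, h6, mul_zero,
          zero_add]
      rw [Odd.neg_one_zpow ⟨l, rfl⟩, neg_one_mul, nEps_odd, add_mul, one_mul, add_mul, add_mul,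
        one_mul, mul_add, smul_mul_assoc, smul_mul_assoc, hyp_mul_angle, smul_mul_assoc,
        hyp_mul_angle, mul_smul_comm, h2, h3, h4, smul_neg]
      rw [mul_zero]
      abel
  have e2 : eps k * symb ((-1) ^ n * u) * (eps k * symb ((-1) ^ n * -u)) = 0 := by
    rw [mul_neg, mul_assoc, ← mul_assoc (symb _), ← eps_mul_symb, mul_assoc (eps k) (symb _),
      symb_mul_symb_neg, mul_zero, mul_zero]
  simp only [residueMatrix, Matrix.mul_fin_two, e1, e2, symb_mul_symb_neg]
  ext i j; fin_cases i <;> fin_cases j <;> simp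

theorem decomposition_aux {R K : Type*} [CommRing R] [Field K] [Algebra R K] [IsFractionRing R K]
    {π : R} (hπ : Irreducible π) {u v : Rˣ} {n m : ℤ} (hle : m ≤ n)
    (h : algebraMap R K (u : R) * algebraMap R K π ^ n
      = algebraMap R K (v : R) * algebraMap R K π ^ m) : n = m ∧ u = v := by
  have hπ0 : algebraMap R K π ≠ 0 := by simpa using hπ.ne_zero
  obtain ⟨j, rfl⟩ := Int.exists_add_of_le hle
  rw [zpow_add₀ hπ0, mul_comm (_ ^ m), ← mul_assoc] at h
  have h' := mul_right_cancel₀ (zpow_ne_zero m hπ0) h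
  rw [zpow_natCast, ← map_pow, ← map_mul] at h'
  have h'' := IsFractionRing.injective R K h'
  have hj : j = 0 := by
    by_contra hj
    refine hπ.not_isUnit (isUnit_of_dvd_unit ?_ v.isUnit)
    rw [← h'']
    exact Dvd.dvd.mul_left (dvd_pow_self π hj) _
  subst hj
  refine ⟨by simp, Units.ext ?_⟩
  simpa using h''

variable {R K : Type*} [CommRing R] [IsDomain R] [IsDiscreteValuationRing R] [Field K]
  [Algebra R K] [IsFractionRing R K]

theorem exists_decomposition {π : R} (hπ : Irreducible π) (x : Kˣ) :
    ∃ y : ℤ × Rˣ, (x : K) = algebraMap R K (y.2 : R) * algebraMap R K π ^ y.1 := by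
  obtain ⟨n, u, h⟩ :=
    IsDiscreteValuationRing.exists_units_eq_smul_zpow_of_irreducible hπ x.ne_zero
  exact ⟨(n, u), by rw [h, Units.smul_def, Algebra.smul_def]⟩

/-- The exponent `n` in `x = u π ^ n`, with `u` a unit of the valuation ring. -/
noncomputable def ordNum {π : R} (hπ : Irreducible π) (x : Kˣ) : ℤ :=
  (exists_decomposition hπ x).choose.1

/-- The unit `u` in `x = u π ^ n`. -/
noncomputable def unitPart {π : R} (hπ : Irreducible π) (x : Kˣ) : Rˣ :=
  (exists_decomposition hπ x).choose.2

theorem decomposition {π : R} (hπ : Irreducible π) (x : Kˣ) :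
    (x : K) = algebraMap R K (unitPart hπ x : R) * algebraMap R K π ^ ordNum hπ x :=
  (exists_decomposition hπ x).choose_spec

theorem decomposition_unique {π : R} (hπ : Irreducible π) {x : Kˣ} {u : Rˣ} {n : ℤ}
    (h : (x : K) = algebraMap R K (u : R) * algebraMap R K π ^ n) :
    ordNum hπ x = n ∧ unitPart hπ x = u := by
  have h' := (decomposition hπ x).symm.trans h
  rcases le_total n (ordNum hπ x) with hle | hle
  · exact decomposition_aux hπ hle h'
  · have := decomposition_aux hπ hle h'.symm
    exact ⟨this.1.symm, this.2.symm⟩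

theorem ordNum_mul {π : R} (hπ : Irreducible π) (x y : Kˣ) :
    ordNum hπ (x * y) = ordNum hπ x + ordNum hπ y ∧
      unitPart hπ (x * y) = unitPart hπ x * unitPart hπ y := by
  have hπ0 : algebraMap R K π ≠ 0 := by simpa using hπ.ne_zero
  apply decomposition_unique
  rw [Units.val_mul, decomposition hπ x, decomposition hπ y, zpow_add₀ hπ0, Units.val_mul, map_mul]
  ring

/-- The reduction of a unit of the valuation ring. -/
noncomputable def unitResidue (u : Rˣ) : (ResidueField R)ˣ := Units.map (residue R) u

/-- The value on symbols of the ring homomorphism `residueHom` below. -/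
noncomputable def residueSymb {π : R} (hπ : Irreducible π) (x : Kˣ) :
    Matrix (Fin 2) (Fin 2) (KMW (ResidueField R)) :=
  residueMatrix (ordNum hπ x) (unitResidue (unitPart hπ x))

theorem residueSymb_eq {π : R} (hπ : Irreducible π) {x : Kˣ} {u : Rˣ} {n : ℤ}
    (h : (x : K) = algebraMap R K (u : R) * algebraMap R K π ^ n) :
    residueSymb hπ x = residueMatrix n (unitResidue u) := by
  rw [residueSymb, (decomposition_unique hπ h).1, (decomposition_unique hπ h).2]

theorem residueMatrix_zero_one : residueMatrix 0 (1 : kˣ) = 0 := by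
  ext i j; fin_cases i <;> fin_cases j <;> simp [residueMatrix, nEps_zero, symb_one]

theorem residueMatrix_zero_mul_zero {u v : kˣ} (h : symb u * symb v = 0) :
    residueMatrix 0 u * residueMatrix 0 v = 0 := by
  have h' : eps k * symb u * (eps k * symb v) = 0 := by
    rw [mul_assoc, ← mul_assoc (symb u), ← eps_mul_symb, mul_assoc (eps k) (symb u), h, mul_zero,
      mul_zero]
  ext i j; fin_cases i <;> fin_cases j <;> simp [residueMatrix, nEps_zero, h, h']

theorem residueSymb_of_pos {π : R} (hπ : Irreducible π) {a b : Kˣ} (h : (b : K) = 1 - (a : K))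
    (hn : 0 < ordNum hπ a) : residueSymb hπ b = 0 := by
  obtain ⟨j, hj⟩ := Int.eq_succ_of_zero_lt hn
  set r : R := unitPart hπ a * π ^ (j + 1) with hr
  have hmem : r ∈ maximalIdeal R :=
    Ideal.mul_mem_left _ _ (Ideal.pow_mem_of_mem _ hπ.not_isUnit _ (Nat.succ_pos j))
  have ha : (a : K) = algebraMap R K r := by
    rw [decomposition hπ a, hj, hr, map_mul, map_pow, ← zpow_natCast]
    rfl
  have hres : residue R (1 - r) = 1 := by
    rw [map_sub, map_one, (residue_eq_zero_iff r).mpr hmem, sub_zero]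
  have hu : IsUnit (1 - r) := by
    rw [← residue_ne_zero_iff_isUnit, hres]; exact one_ne_zero
  have hb : (b : K) = algebraMap R K (hu.unit : R) * algebraMap R K π ^ (0 : ℤ) := by
    rw [h, ha, IsUnit.unit_spec, zpow_zero, mul_one, map_sub, map_one]
  have h1 : unitResidue hu.unit = 1 := Units.ext hres
  rw [residueSymb_eq hπ hb, h1, residueMatrix_zero_one]

theorem residueSymb_steinberg {π : R} (hπ : Irreducible π) (a b : Kˣ)
    (h : (b : K) = 1 - (a : K)) : residueSymb hπ a * residueSymb hπ b = 0 := by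
  have hπ0 : algebraMap R K π ≠ 0 := by simpa using hπ.ne_zero
  have h' : (a : K) = 1 - (b : K) := by rw [h]; ring
  rcases lt_trichotomy (ordNum hπ a) 0 with hn | hn | hn
  · obtain ⟨j, hj⟩ := Int.eq_succ_of_zero_lt (neg_pos.mpr hn)
    set r : R := π ^ (j + 1) - unitPart hπ a with hr
    have hpow : π ^ (j + 1) ∈ maximalIdeal R :=
      Ideal.pow_mem_of_mem _ hπ.not_isUnit _ (Nat.succ_pos j)
    have hres : residue R r = -residue R (unitPart hπ a : R) := by
      rw [hr, map_sub, (residue_eq_zero_iff _).mpr hpow, zero_sub]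
    have hu : IsUnit r := by
      rw [← residue_ne_zero_iff_isUnit, hres, neg_ne_zero, residue_ne_zero_iff_isUnit]
      exact (unitPart hπ a).isUnit
    have hb : (b : K) = algebraMap R K (hu.unit : R) * algebraMap R K π ^ ordNum hπ a := by
      have hone : algebraMap R K π ^ (j + 1) * algebraMap R K π ^ ordNum hπ a = 1 := by
        rw [← zpow_natCast, ← zpow_add₀ hπ0]
        have : ((j + 1 : ℕ) : ℤ) + ordNum hπ a = 0 := by push_cast; omega
        rw [this, zpow_zero]
      rw [IsUnit.unit_spec, hr, map_sub, map_pow, sub_mul, hone, ← decomposition hπ a, h]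
    have h1 : unitResidue hu.unit = -unitResidue (unitPart hπ a) := Units.ext hres
    rw [residueSymb_eq hπ hb, h1]
    exact residueMatrix_mul_neg _ _
  · rcases lt_trichotomy (ordNum hπ b) 0 with hm | hm | hm
    · exfalso
      obtain ⟨j, hj⟩ := Int.eq_succ_of_zero_lt (neg_pos.mpr hm)
      have hb := decomposition hπ b
      have ha := decomposition hπ a
      rw [hn, zpow_zero, mul_one] at ha
      have hone : algebraMap R K π ^ ordNum hπ b * algebraMap R K π ^ (j + 1) = 1 := by
        rw [← zpow_natCast, ← zpow_add₀ hπ0]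
        have : ordNum hπ b + ((j + 1 : ℕ) : ℤ) = 0 := by push_cast; omega
        rw [this, zpow_zero]
      have key : algebraMap R K (unitPart hπ b : R)
          = algebraMap R K ((1 - unitPart hπ a) * π ^ (j + 1)) := by
        rw [map_mul, map_pow, map_sub, map_one, ← ha, ← h, hb, mul_assoc, hone, mul_one]
      have key' := IsFractionRing.injective R K key
      refine hπ.not_isUnit (isUnit_of_dvd_unit ?_ (unitPart hπ b).isUnit)
      rw [key']
      exact Dvd.dvd.mul_left (dvd_pow_self π (Nat.succ_ne_zero j)) _
    · rw [residueSymb, residueSymb, hn, hm]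
      apply residueMatrix_zero_mul_zero
      apply symb_mul_symb_eq_zero
      have ha := decomposition hπ a
      have hb := decomposition hπ b
      rw [hn, zpow_zero, mul_one] at ha
      rw [hm, zpow_zero, mul_one] at hb
      have key : algebraMap R K (unitPart hπ b : R)
          = algebraMap R K (1 - unitPart hπ a) := by
        rw [map_sub, map_one, ← ha, ← hb, h]
      have key' := congrArg (residue R) (IsFractionRing.injective R K key)
      rw [map_sub, map_one] at key'
      exact key'
    · rw [residueSymb_of_pos hπ h' hm, zero_mul]
  · rw [residueSymb_of_pos hπ h hn, mul_zero]

/-- The ring homomorphism `K_*^MW(K) → K_*^MW(k)[ξ]/(ξ² = ξ[-1])` with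
`[u π ^ n] ↦ [ū] + n_ε ⟨ū⟩ ξ` and `η ↦ η`, where `k` is the residue field and `ξ` has degree `1`
(so that `[a] ξ = ε ξ [a]`). The element `x + ξ y` of the target is represented by the
matrix of left multiplication by it in the right basis `1, ξ`; its first column is `x, y`. -/
noncomputable def residueHom (K : Type*) [Field K] [Algebra R K] [IsFractionRing R K] {π : R}
    (hπ : Irreducible π) : KMW K →+* Matrix (Fin 2) (Fin 2) (KMW (ResidueField R)) :=
  lift (residueSymb hπ) !![eta (ResidueField R), 0; 0, eta (ResidueField R)]
    (residueSymb_steinberg hπ)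
    (fun a b => by
      rw [residueSymb, (ordNum_mul hπ a b).1, (ordNum_mul hπ a b).2, unitResidue, map_mul]
      exact residueMatrix_mul _ _ _ _)
    (fun a => by
      have h1 (n : ℤ) (u : (ResidueField R)ˣ) : eta (ResidueField R) * (nEps _ n * angle u)
          = nEps _ n * angle u * eta _ := by
        rw [← mul_assoc, eta_mul_nEps, mul_assoc, ← angle_mul_eta, mul_assoc]
      have h2 (u : (ResidueField R)ˣ) : eta (ResidueField R) * (eps _ * symb u)
          = eps _ * symb u * eta _ := by
        rw [← mul_assoc, eta_mul_eps, mul_assoc, ← eta_mul_symb, ← mul_assoc, eps_mul_eta]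
      simp only [residueSymb, residueMatrix, Matrix.mul_fin_two, h1, h2, eta_mul_symb]
      ext i j; fin_cases i <;> fin_cases j <;> simp)
    (by
      have h0 : residueSymb (K := K) hπ (-1) = residueMatrix 0 (-1) := by
        have h1 : ((-1 : Kˣ) : K)
            = algebraMap R K ((-1 : Rˣ) : R) * algebraMap R K π ^ (0 : ℤ) := by simp
        rw [residueSymb_eq hπ h1]
        congr 1
      have h2 : (2 : Matrix (Fin 2) (Fin 2) (KMW (ResidueField R))) = !![2, 0; 0, 2] := by
        ext i j; fin_cases i <;> fin_cases j <;> rfl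
      have h3 : (2 + eta (ResidueField R) * symb (-1)) * eta _ = 0 := hyp_mul_eta
      have h4 : (2 + eta (ResidueField R) * (eps _ * symb (-1))) * eta _ = 0 := by
        rw [← mul_assoc (eta _) (eps _), eta_mul_eps, h3]
      rw [h0, h2]
      ext i j
      fin_cases i <;> fin_cases j <;>
        simp [residueMatrix, nEps_zero, h3, h4])

/-- The residue map `∂^π : K_*^MW(K) → K_{*-1}^MW(k)` with respect to the uniformizer `π`: the
coefficient of `ξ` under `residueHom`. It commutes with `η`, kills `[u₁, …, uₙ]` and sends
`[π, u₁, …, uₙ]` to `[ū₁, …, ūₙ]` for units `uᵢ`. -/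
noncomputable def residueMap (K : Type*) [Field K] [Algebra R K] [IsFractionRing R K] {π : R}
    (hπ : Irreducible π) : KMW K →+ KMW (ResidueField R) :=
  AddMonoidHom.mk' (fun x => residueHom K hπ x 1 0) (by
    intro x y
    rw [map_add, Matrix.add_apply])

/-- The twisted Milnor–Witt K-theory `K_*^MW(k) ⊗_{ℤ[kˣ]} ℤ[V ∖ 0]` of a `k`-vector space `V`
(of dimension one), where `u` in `kˣ` acts by `⟨u⟩` on the left factor: `single f x` is `x ⊗ f`. -/
def KMWTwist (k V : Type*) [Field k] [AddCommGroup V] [Module k V] : Type _ :=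
  ({f : V // f ≠ 0} →₀ KMW k) ⧸ AddSubgroup.closure
    {z | ∃ (u : kˣ) (f g : {f : V // f ≠ 0}) (x : KMW k), (g : V) = (u : k) • (f : V) ∧
      z = Finsupp.single f (angle u * x) - Finsupp.single g x}

noncomputable instance (k V : Type*) [Field k] [AddCommGroup V] [Module k V] :
    AddCommGroup (KMWTwist k V) :=
  inferInstanceAs (AddCommGroup (_ ⧸ AddSubgroup.closure _))

/-- The element `x ⊗ f`. -/
noncomputable def KMWTwist.tmul {k V : Type*} [Field k] [AddCommGroup V] [Module k V]
    (f : {f : V // f ≠ 0}) : KMW k →+ KMWTwist k V :=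
  (QuotientAddGroup.mk' _).comp (Finsupp.singleAddHom f)

theorem toCotangent_ne_zero {π : R} (hπ : Irreducible π) :
    (maximalIdeal R).toCotangent ⟨π, hπ.not_isUnit⟩ ≠ 0 := by
  intro h0
  have h : π ∈ maximalIdeal R ^ 2 := (Ideal.toCotangent_eq_zero _ _).mp h0
  rw [hπ.maximalIdeal_eq, Ideal.span_singleton_pow, Ideal.mem_span_singleton] at h
  have h1 : π * π ∣ π * 1 := by simpa [pow_two] using h
  exact hπ.not_isUnit (isUnit_of_dvd_one ((mul_dvd_mul_iff_left hπ.ne_zero).mp h1))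

/-- The basis of `(𝔪/𝔪²)^∨` dual to the class of the uniformizer `π`. -/
noncomputable def dualUniformizer {π : R} (hπ : Irreducible π) :
    {f : Module.Dual (ResidueField R) (CotangentSpace R) // f ≠ 0} :=
  ⟨(FiniteDimensional.basisSingleton Unit (finrank_CotangentSpace_eq_one R) _
      (toCotangent_ne_zero hπ)).coord (), by
    intro h
    have h1 := Module.Basis.coord_apply (FiniteDimensional.basisSingleton Unit
      (finrank_CotangentSpace_eq_one R) _ (toCotangent_ne_zero hπ)) ()
        (FiniteDimensional.basisSingleton Unit (finrank_CotangentSpace_eq_one R) _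
          (toCotangent_ne_zero hπ) ())
    rw [h, Module.Basis.repr_self] at h1
    simp at h1⟩

/-- The twisted residue map `∂_v : K_*^MW(K) → K_{*-1}^MW(k, (𝔪/𝔪²)^∨)`, written in terms of a
uniformizer `π` (on which it does not depend): `[π, u₁, …, uₙ] ↦ [ū₁, …, ūₙ] ⊗ π̄^∨`. -/
noncomputable def twistedResidue (K : Type*) [Field K] [Algebra R K] [IsFractionRing R K] {π : R}
    (hπ : Irreducible π) :
    KMW K →+ KMWTwist (ResidueField R) (Module.Dual (ResidueField R) (CotangentSpace R)) :=
  (KMWTwist.tmul (dualUniformizer hπ)).comp (residueMap K hπ)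

/-- `K_1^MW(𝒪_v)`: the kernel of the (twisted) residue map on `K_1^MW(F_v)`. -/
noncomputable def K1Integers (K : Type*) [Field K] [Algebra R K] [IsFractionRing R K] {π : R}
    (hπ : Irreducible π) : AddSubgroup (K1 K) :=
  ((twistedResidue K hπ).comp (K1.incl K)).ker

end Residue

/-! ### Coverings of topological groups -/

/-- A homomorphism of (commutative) topological groups that is a covering, i.e. a surjective
covering map. -/
structure IsTopGroupCovering {G H : Type*} [AddCommGroup G] [TopologicalSpace G] [AddCommGroup H]
    [TopologicalSpace H] (f : G →+ H) : Prop where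
  isTopologicalAddGroup_source : IsTopologicalAddGroup G
  isTopologicalAddGroup_target : IsTopologicalAddGroup H
  isCoveringMap : IsCoveringMap f
  surjective : Function.Surjective f

end MilnorWitt

/-! The covering statement needs only that squares are open in `F_v^×`, which holds because squaring
has invertible derivative 2 at 1. Composed with `p`, the embedding of the squares into `K_1^MW` is
the inclusion of an open subgroup. In the coset topology every coset is open and is mapped
homeomorphically onto an open coset downstairs, so the kernel is discrete and a translated local
section trivialises `p`. Nothing about the size of the kernel is used, so all places are treated
alike (`isTopGroupCovering_p`).

At a finite place everything else rests on the kernel having exactly two elements. The elements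
η[a][b] behave like Pfister forms: the Steinberg relation makes η[a][b] vanish when b is a value of
x² - ay², that is, lies in `normGroup a`. If all norm groups have index at most 2, any two nonzero
η[a][b] coincide. If moreover some Δ lies in its own norm group without that group being everything,
the common value τ satisfies 2τ = 0 and is fixed by all ⟨c⟩. Expanding monomials then shows that
each element of `K_1^MW` is [a] or [a] + τ, whence the kernel is {0, τ}
(`NormIndexTwo.mem_ker_iff`).

To see τ ≠ 0, the norm residue symbol, bilinear by the index bound, is used to build a model of the
Witt ring modulo I³ on which `KMW` acts with η as 1 and [a] as ⟨a⟩ - 1. There η[a][b] sends the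
class of 1 to the value of the symbol (`SteinbergSymbol.pfister_ne_zero`).

The index bound (`mul_mem_normGroup`) comes from the filtration of the units by powers of π, residue
characteristic 2 included: at every level except at most one the norms fill the graded piece, and at
the exceptional level they miss at most half of it. The element Δ = 1 + 4ρ generates the unramified
quadratic extension: all units are norms, but a uniformizer is not.

Finite fibres make `p` proper, so local compactness lifts from `F_v^×`; total disconnectedness lifts
along any covering. Finally, the rank of the residue of z is the valuation of p(z), so `K1Integers`
lies in the compact preimage of the units; it is closed because it is an open subgroup. -/

namespace MilnorWitt

/-! ### Values of the binary forms x² - ay² -/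

section NormGroup

variable {F : Type*} [Field F]

/-- The group of nonzero values of the binary form `x ^ 2 - a * y ^ 2`. -/
def normGroup (a : Fˣ) : Subgroup Fˣ where
  carrier := {b | ∃ x y : F, (b : F) = x ^ 2 - a * y ^ 2}
  mul_mem' := by
    rintro b c ⟨x, y, h⟩ ⟨z, w, h'⟩
    exact ⟨x * z + a * y * w, x * w + y * z, by rw [Units.val_mul, h, h']; ring⟩
  one_mem' := ⟨1, 0, by simp⟩
  inv_mem' := by
    rintro b ⟨x, y, h⟩
    refine ⟨x * (b : F)⁻¹, y * (b : F)⁻¹, ?_⟩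
    have hb : (b : F) ≠ 0 := b.ne_zero
    have : x ^ 2 - (a : F) * y ^ 2 = b := h.symm
    rw [Units.val_inv_eq_inv_val, mul_pow, mul_pow, ← mul_assoc, ← sub_mul, this]
    field_simp

theorem sq_mem_normGroup (a b : Fˣ) : b ^ 2 ∈ normGroup a := ⟨b, 0, by simp⟩

theorem neg_self_mem_normGroup (a : Fˣ) : -a ∈ normGroup a := ⟨0, 1, by simp⟩

theorem sq_mul_mem_normGroup {a b c : Fˣ} : c ^ 2 * b ∈ normGroup a ↔ b ∈ normGroup a :=
  Subgroup.mul_mem_cancel_left _ (sq_mem_normGroup a c)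

/-- This is the symmetry of the Hilbert symbol. If b = x² - ay² with y ≠ 0, solve for a. -/
theorem mem_normGroup_comm [NeZero (2 : F)] {a b : Fˣ} (h : b ∈ normGroup a) :
    a ∈ normGroup b := by
  obtain ⟨x, y, h⟩ := h
  have h2 : (2 : F) ≠ 0 := NeZero.ne 2
  by_cases hy : y = 0
  · subst hy
    have hx : x ≠ 0 := by rintro rfl; simp at h
    -- Here b is a square, so the form for b is hyperbolic and represents everything: a = ((a+1)/2)²
    -- - ((a-1)/2)².
    refine ⟨(a + 1) / 2, (a - 1) / (2 * x), ?_⟩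
    rw [h]; field_simp; ring
  · refine ⟨x / y, 1 / y, ?_⟩
    rw [h]; field_simp; ring

theorem normGroup_sq_mul (a c : Fˣ) : normGroup (c ^ 2 * a) = normGroup a := by
  have hc : (c : F) ≠ 0 := c.ne_zero
  ext b
  constructor
  · rintro ⟨x, y, h⟩
    exact ⟨x, c * y, by rw [h]; push_cast; ring⟩
  · rintro ⟨x, y, h⟩
    exact ⟨x, y / c, by rw [h]; push_cast; field_simp⟩

end NormGroup

/-! ### The elements η[a][b] and their vanishing on norms -/

section Pfister

variable {F : Type*} [Field F]

theorem eta_mul_hyp : eta F * hyp F = 0 := by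
  rw [hyp_eq, mul_add, mul_one, ← angle_mul_eta, ← hyp_mul_eta (F := F), hyp_eq, add_mul, one_mul]

theorem angle_eq (a : Fˣ) : eta F * symb a = angle a - 1 := by
  rw [angle, add_sub_cancel_left]

/-- The element `η[a][b]` of `K_*^MW(F)`. -/
noncomputable def pfister (a b : Fˣ) : KMW F := eta F * symb a * symb b

theorem pfister_comm (a b : Fˣ) : pfister a b = pfister b a := eta_mul_symb_mul_symb_comm a b

theorem pfister_one (a : Fˣ) : pfister a 1 = 0 := by rw [pfister, symb_one, mul_zero]

theorem pfister_eq_zero_of_mul {a b : Fˣ} (h : symb a * symb b = 0) : pfister a b = 0 := by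
  rw [pfister, mul_assoc, h, mul_zero]

/-- Multiply [cb] = [c] + ⟨c⟩[b] by η[a]. This turns the action of ⟨c⟩ into a difference of elements
of the same shape. -/
theorem angle_mul_pfister (a b c : Fˣ) :
    angle c * pfister a b = pfister a (c * b) - pfister a c := by
  have h : angle c * pfister a b = eta F * symb a * (angle c * symb b) := by
    rw [pfister, ← mul_assoc, ← mul_assoc, angle_mul_eta, mul_assoc (eta F), angle_mul_symb]
    simp only [mul_assoc]
  rw [h, pfister, pfister, symb_mul_eq, mul_add, add_sub_cancel_left]

theorem pfister_mul_angle (a b c : Fˣ) : pfister a b * angle c = angle c * pfister a b := by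
  rw [pfister, mul_assoc, ← angle_mul_symb, ← mul_assoc, mul_assoc (eta F), ← angle_mul_symb,
    ← mul_assoc, ← angle_mul_eta]
  simp only [mul_assoc]

theorem eta_mul_symb_sq (c : Fˣ) : eta F * symb (c ^ 2) = 0 := by
  rw [← hyp_mul_symb, ← mul_assoc, eta_mul_hyp, zero_mul]

theorem pfister_sq_mul (a b c : Fˣ) : pfister a (c ^ 2 * b) = pfister a b := by
  rw [pfister_comm, pfister_comm a, pfister, symb_mul, mul_add, mul_add, eta_mul_symb_sq,
    zero_mul, mul_zero, add_zero, zero_add, pfister]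

/-- Both slots only matter modulo squares. If x, y ≠ 0, dividing by x² gives b ~ 1 - c²a with c =
y/x, and the Steinberg relation applies. If y = 0, b is a square; if x = 0, b ~ -a and [a][-a] = 0.
-/
theorem pfister_eq_zero {a b : Fˣ} (h : b ∈ normGroup a) : pfister a b = 0 := by
  obtain ⟨x, y, h⟩ := h
  by_cases hy : y = 0
  · subst hy
    have hx : x ≠ 0 := by rintro rfl; simp at h
    have hb : b = Units.mk0 x hx ^ 2 * 1 := by ext; simpa using h
    rw [hb, pfister_sq_mul, pfister_one]
  · by_cases hx : x = 0
    · subst hx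
      have hb : b = Units.mk0 y hy ^ 2 * -a := by
        ext; simp only [Units.val_mul, Units.val_pow_eq_pow_val, Units.val_mk0, Units.val_neg, h]
        ring
      rw [hb, pfister_sq_mul, pfister_eq_zero_of_mul (symb_mul_symb_neg a)]
    · set c : Fˣ := Units.mk0 (y / x) (div_ne_zero hy hx) with hc
      set w : Fˣ := (Units.mk0 x hx)⁻¹ ^ 2 * b with hw
      have hwv : (w : F) = 1 - ((c ^ 2 * a : Fˣ) : F) := by
        simp only [hw, hc, Units.val_mul, Units.val_pow_eq_pow_val, Units.val_mk0,
          Units.val_inv_eq_inv_val, h]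
        field_simp
      have h0 := pfister_eq_zero_of_mul (symb_mul_symb_eq_zero _ _ hwv)
      rwa [pfister_comm, pfister_sq_mul, pfister_comm, hw, pfister_sq_mul] at h0

theorem pfister_mul_of_mem {a b c : Fˣ} (h : c ∈ normGroup a) :
    pfister a (b * c) = pfister a b := by
  have := angle_mul_pfister a c b
  rw [pfister_eq_zero h, mul_zero] at this
  exact sub_eq_zero.mp this.symm

theorem pfister_eq_of_mul_mem {a b c : Fˣ} (h : b * c ∈ normGroup a) :
    pfister a b = pfister a c := by
  rw [← pfister_mul_of_mem h, ← mul_assoc, ← pow_two, pfister_sq_mul]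

end Pfister

/-! ### Norm groups of index at most two and the kernel of `p` -/

theorem exists_notMem_and_notMem {G : Type*} [Group G] {H K : Subgroup G} {x y : G}
    (hx : x ∉ H) (hy : y ∉ K) : ∃ z, z ∉ H ∧ z ∉ K := by
  by_cases hxK : x ∈ K
  · by_cases hyH : y ∈ H
    · exact ⟨x * y, fun h => hx ((H.mul_mem_cancel_right hyH).mp h),
        fun h => hy ((K.mul_mem_cancel_left hxK).mp h)⟩
    · exact ⟨y, hyH, hy⟩
  · exact ⟨x, hx, hxK⟩

/-- The features of the norm residue symbol of a nonarchimedean local field that determine the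
kernel of `p`: all norm groups have index at most `2`, and `Δ` is a norm from `F(√Δ)` but `ϖ` is not. -/
structure NormIndexTwo (F : Type*) [Field F] (Δ ϖ : Fˣ) : Prop where
  mul_mem : ∀ a x y : Fˣ, x ∉ normGroup a → y ∉ normGroup a → x * y ∈ normGroup a
  self_mem : Δ ∈ normGroup Δ
  notMem : ϖ ∉ normGroup Δ

namespace NormIndexTwo

variable {F : Type*} [Field F] [NeZero (2 : F)] {Δ ϖ : Fˣ} (h : NormIndexTwo F Δ ϖ)
include h

theorem pfister_eq {x y : Fˣ} (hy : y ∉ normGroup x) : pfister x y = pfister Δ ϖ := by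
  -- A group is not the union of two proper subgroups. The chosen b links the pairs (x, y), (x, b),
  -- (Δ, b), (Δ, ϖ): neighbours share a slot, and their other entries both lie outside the norm
  -- group of that slot, so their product lies inside.
  obtain ⟨b, hb, hb'⟩ := exists_notMem_and_notMem hy h.notMem
  have h1 : x ∉ normGroup b := fun h' => hb (mem_normGroup_comm h')
  have h2 : Δ ∉ normGroup b := fun h' => hb' (mem_normGroup_comm h')
  rw [pfister_eq_of_mul_mem (h.mul_mem x y b hy hb), pfister_comm,
    pfister_eq_of_mul_mem (h.mul_mem b x Δ h1 h2), pfister_comm,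
    pfister_eq_of_mul_mem (h.mul_mem Δ b ϖ hb' h.notMem)]

theorem angle_mul_of_mem {c : Fˣ} (hc : c ∈ normGroup Δ) :
    angle c * pfister Δ ϖ = pfister Δ ϖ := by
  have hn : c * ϖ ∉ normGroup Δ := fun h' => h.notMem ((Subgroup.mul_mem_cancel_left _ hc).mp h')
  rw [angle_mul_pfister, pfister_eq_zero hc, h.pfister_eq hn, sub_zero]

theorem angle_mul_of_notMem {c : Fˣ} (hc : c ∉ normGroup Δ) :
    angle c * pfister Δ ϖ = -pfister Δ ϖ := by
  rw [angle_mul_pfister, pfister_eq_zero (h.mul_mem Δ c ϖ hc h.notMem), h.pfister_eq hc, zero_sub]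

/-- Compute ⟨Δ⟩τ twice. With Δ in the slot being multiplied, Δ² is a square and the result is -τ; as
Δ is a norm for the form attached to Δ, the result is also τ. -/
theorem neg_pfister : -pfister Δ ϖ = pfister Δ ϖ := by
  have h1 : Δ ∉ normGroup ϖ := fun h' => h.notMem (mem_normGroup_comm h')
  have h2 : angle Δ * pfister Δ ϖ = -pfister Δ ϖ := by
    rw [pfister_comm, angle_mul_pfister, ← pow_two, pfister_eq_zero (sq_mem_normGroup _ _),
      zero_sub]
  rw [← h2, h.angle_mul_of_mem h.self_mem]

theorem angle_mul (c : Fˣ) : angle c * pfister Δ ϖ = pfister Δ ϖ := by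
  by_cases hc : c ∈ normGroup Δ
  · exact h.angle_mul_of_mem hc
  · rw [h.angle_mul_of_notMem hc, h.neg_pfister]

theorem pfister_mem (x y : Fˣ) : pfister x y = 0 ∨ pfister x y = pfister Δ ϖ := by
  by_cases hy : y ∈ normGroup x
  · exact Or.inl (pfister_eq_zero hy)
  · exact Or.inr (h.pfister_eq hy)

/-- The second factor is a product of terms η[c] = ⟨c⟩ - 1, each of which kills η[x][y] because
every ⟨c⟩ fixes τ. Only the empty product survives. -/
theorem pfister_mul_prod (x y : Fˣ) (l : List Fˣ) :
    pfister x y * (eta F ^ l.length * (l.map symb).prod) = 0 ∨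
    pfister x y * (eta F ^ l.length * (l.map symb).prod) = pfister Δ ϖ := by
  cases l with
  | nil => simpa using h.pfister_mem x y
  | cons c l =>
    left
    have hc : Commute (symb c) (eta F ^ l.length) :=
      Commute.pow_right (eta_mul_symb c).symm _
    have h0 : pfister x y * (eta F * symb c) = 0 := by
      rw [angle_eq, mul_sub, mul_one, pfister_mul_angle]
      rcases h.pfister_mem x y with h1 | h1
      · rw [h1]; simp
      · rw [h1, h.angle_mul, sub_self]
    rw [List.length_cons, List.map_cons, List.prod_cons, pow_succ', ← mul_assoc (_ * _) (symb c),
      mul_assoc (eta F), ← hc.eq, ← mul_assoc (eta F), mul_assoc (_ * _), ← mul_assoc, h0, zero_mul]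

/-- Modulo {0, τ} the map a ↦ [a] is additive, since [ab] - [a] - [b] = η[a][b], and all longer
monomials of degree 1 lie in {0, τ} already. -/
theorem exists_sub_symb (z : KMW F) (hz : z ∈ degreePart F 1) :
    ∃ a : Fˣ, z - symb a = 0 ∨ z - symb a = pfister Δ ϖ := by
  have key (x y : KMW F) (hx : x = 0 ∨ x = pfister Δ ϖ) (hy : y = 0 ∨ y = pfister Δ ϖ) :
      x - y = 0 ∨ x - y = pfister Δ ϖ := by
    rcases hx with rfl | rfl <;> rcases hy with rfl | rfl <;> simp [h.neg_pfister]
  have keyn (x : KMW F) (hx : x = 0 ∨ x = pfister Δ ϖ) :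
      -x = 0 ∨ -x = pfister Δ ϖ := by
    rcases hx with rfl | rfl <;> simp [h.neg_pfister]
  induction hz using AddSubgroup.closure_induction with
  | mem x hx =>
    obtain ⟨m, l, hl, rfl⟩ := hx
    match l, m, hl with
    | [], m, hl => simp at hl; omega
    | [a], m, hl =>
      obtain rfl : m = 0 := by simpa using hl
      exact ⟨a, by simp⟩
    | a :: b :: l, m, hl =>
      -- One η is spent on a and b; the others match the remaining symbols one to one.
      obtain rfl : m = l.length + 1 := by simp at hl; omega
      refine ⟨1, ?_⟩
      have hc : Commute (symb a * symb b) (eta F ^ l.length) :=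
        Commute.pow_right (Commute.mul_left (eta_mul_symb a).symm (eta_mul_symb b).symm) _
      have : eta F ^ (l.length + 1) * ((a :: b :: l).map symb).prod
          = pfister a b * (eta F ^ l.length * (l.map symb).prod) := by
        rw [List.map_cons, List.map_cons, List.prod_cons, List.prod_cons, pow_succ', pfister,
          mul_assoc (eta F) (symb a), mul_assoc (eta F) (symb a * symb b), ← mul_assoc (_ * _) (_ ^ _),
          hc.eq]
        simp only [mul_assoc]
      rw [this, symb_one, sub_zero]
      exact h.pfister_mul_prod a b l
  | zero => exact ⟨1, by simp [symb_one]⟩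
  | add x y _ _ hx hy =>
    obtain ⟨a, ha⟩ := hx
    obtain ⟨b, hb⟩ := hy
    refine ⟨a * b, ?_⟩
    have : x + y - symb (a * b) = (x - symb a) - (-(y - symb b)) - pfister a b := by
      rw [symb_mul, pfister]; abel
    rw [this]
    exact key _ _ (key _ _ ha (keyn _ hb)) (h.pfister_mem a b)
  | neg x _ hx =>
    obtain ⟨a, ha⟩ := hx
    refine ⟨a⁻¹, ?_⟩
    have : -x - symb a⁻¹ = pfister a⁻¹ a - (x - symb a) := by
      rw [symb_inv, pfister, angle]; noncomm_ring
    rw [this]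
    exact key _ _ (h.pfister_mem _ _) ha

end NormIndexTwo

theorem p_apply {F : Type*} [Field F] (z : K1 F) :
    p F z = (toMilnorTrunc F (K1.incl F z) (1, 0)).2 := rfl

theorem toMilnorTrunc_eta (F : Type*) [Field F] : toMilnorTrunc F (eta F) = 0 := by
  exact lift_eta ..

/-- `η[a][b]` as an element of `K_1^MW(F)`. -/
noncomputable def K1.pfister {F : Type*} [Field F] (a b : Fˣ) : K1 F :=
  ⟨MilnorWitt.pfister a b, AddSubgroup.subset_closure ⟨1, [a, b], by simp, by
    simp [MilnorWitt.pfister, mul_assoc]⟩⟩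

theorem p_pfister {F : Type*} [Field F] (a b : Fˣ) : p F (K1.pfister a b) = 0 := by
  change (toMilnorTrunc F (pfister a b) (1, 0)).2 = 0
  rw [pfister, map_mul, map_mul, toMilnorTrunc_eta, zero_mul, zero_mul]
  rfl

theorem p_surjective (F : Type*) [Field F] : Function.Surjective (p F) :=
  fun x => ⟨K1.symb x.toMul, p_symb _⟩

/-- Write z as [a] plus 0 or τ. Since `p` kills τ and sends [a] to a, z in the kernel forces a = 1.
-/
theorem NormIndexTwo.mem_ker_iff {F : Type*} [Field F] [NeZero (2 : F)] {Δ ϖ : Fˣ}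
    (h : NormIndexTwo F Δ ϖ) (z : K1 F) : p F z = 0 ↔ z = 0 ∨ z = K1.pfister Δ ϖ := by
  constructor
  · intro hz
    obtain ⟨a, ha⟩ := h.exists_sub_symb (K1.incl F z) z.2
    have h1 : z - K1.symb a = 0 ∨ z - K1.symb a = K1.pfister Δ ϖ :=
      ha.imp (fun h => Subtype.ext h) (fun h => Subtype.ext h)
    have h2 : p F (z - K1.symb a) = 0 := by
      rcases h1 with h1 | h1
      · rw [h1, map_zero]
      · rw [h1, p_pfister]
    rw [map_sub, hz, p_symb, zero_sub, neg_eq_zero] at h2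
    obtain rfl : a = 1 := h2
    have h3 : K1.symb (1 : Fˣ) = 0 := Subtype.ext symb_one
    rwa [h3, sub_zero] at h1
  · rintro (rfl | rfl)
    · exact map_zero _
    · exact p_pfister _ _

end MilnorWitt

namespace MilnorWitt

/-! ### A representation of Milnor–Witt K-theory attached to a symbol -/

/-- The extension of `V` by `ZMod 2` with the symmetric bilinear cocycle `β`. -/
@[ext] structure SymbolExt {V : Type*} [AddCommGroup V] (β : V →+ V →+ ZMod 2) where
  /-- the component in `V` -/
  fst : V
  /-- the component in `ZMod 2` -/
  snd : ZMod 2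

theorem mul_sub_one_eq {R : Type*} [Ring R] (x y : R) :
    x * y - 1 = x - 1 + (y - 1) + 1 * (x - 1) * (y - 1) := by noncomm_ring

/-- A bilinear symmetric symbol with values in `ZMod 2` satisfying the Steinberg relation. -/
structure SteinbergSymbol (F : Type*) [Field F] where
  /-- the symbol -/
  toFun : Additive Fˣ →+ Additive Fˣ →+ ZMod 2
  symm : ∀ a b, toFun a b = toFun b a
  steinberg : ∀ a b : Fˣ, (b : F) = 1 - (a : F) → toFun (.ofMul a) (.ofMul b) = 0
  self : ∀ a, toFun a a = toFun (.ofMul (-1)) a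

namespace SteinbergSymbol

variable {F : Type*} [Field F] (β : SteinbergSymbol F)

/-- The extension of `Fˣ` by `ZMod 2` whose cocycle is the symbol. -/
def Ext : Type _ := SymbolExt β.toFun

variable {β} in
theorem Ext.ext {x y : β.Ext} (h : x.fst = y.fst) (h' : x.snd = y.snd) : x = y :=
  SymbolExt.ext h h'

instance : Add β.Ext := ⟨fun x y => ⟨x.fst + y.fst, x.snd + y.snd + β.toFun x.fst y.fst⟩⟩
instance : Zero β.Ext := ⟨⟨0, 0⟩⟩
instance : Neg β.Ext := ⟨fun x => ⟨-x.fst, x.snd + β.toFun x.fst x.fst⟩⟩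

theorem fst_add (x y : β.Ext) : (x + y).fst = x.fst + y.fst := rfl
theorem snd_add (x y : β.Ext) : (x + y).snd = x.snd + y.snd + β.toFun x.fst y.fst := rfl
theorem fst_zero : (0 : β.Ext).fst = 0 := rfl
theorem snd_zero : (0 : β.Ext).snd = 0 := rfl

theorem zmod_two_add_self (x : ZMod 2) : x + x = 0 := CharTwo.add_self_eq_zero x

instance : AddCommGroup β.Ext where
  add_assoc x y z := by
    refine Ext.ext ?_ ?_
    · simp only [fst_add, add_assoc]
    · simp only [fst_add, snd_add, map_add, AddMonoidHom.add_apply]; abel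
  zero_add x := by refine Ext.ext ?_ ?_ <;> simp [fst_add, snd_add, fst_zero, snd_zero]
  add_zero x := by refine Ext.ext ?_ ?_ <;> simp [fst_add, snd_add, fst_zero, snd_zero]
  add_comm x y := by
    refine Ext.ext ?_ ?_
    · simp only [fst_add, add_comm]
    · simp only [snd_add, β.symm x.fst, add_comm x.snd]
  neg_add_cancel x := by
    refine Ext.ext ?_ ?_
    · exact neg_add_cancel x.fst
    · change x.snd + β.toFun x.fst x.fst + x.snd + β.toFun (-x.fst) x.fst = 0
      rw [map_neg, AddMonoidHom.neg_apply, add_right_comm, add_neg_cancel_right,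
        zmod_two_add_self]
  nsmul := nsmulRec
  zsmul := zsmulRec

/-- The class of the form `⟨a⟩ - 1`. -/
def of (a : Fˣ) : β.Ext := ⟨.ofMul a, 0⟩

/-- The inclusion of the kernel of the extension. -/
def inr : ZMod 2 →+ β.Ext where
  toFun s := ⟨0, s⟩
  map_zero' := rfl
  map_add' s t := by
    refine Ext.ext ?_ ?_
    · exact (add_zero (0 : Additive Fˣ)).symm
    · change s + t = s + t + β.toFun 0 0
      rw [map_zero, add_zero]

/-- The projection of the extension. -/
def fstHom : β.Ext →+ Additive Fˣ where
  toFun x := x.fst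
  map_zero' := rfl
  map_add' _ _ := rfl

theorem fstHom_of (a : Fˣ) : β.fstHom (β.of a) = .ofMul a := rfl
theorem fstHom_inr (s : ZMod 2) : β.fstHom (β.inr s) = 0 := rfl

/-- This is ⟨ab⟩ - 1 = (⟨a⟩ - 1) + (⟨b⟩ - 1) + (⟨a⟩ - 1)(⟨b⟩ - 1), the product being modelled by the
symbol. The correction cancels the cocycle because 2 = 0 in `ZMod 2`. -/
theorem of_mul (a b : Fˣ) :
    β.of (a * b) = β.of a + β.of b + β.inr (β.toFun (.ofMul a) (.ofMul b)) := by
  refine Ext.ext ?_ ?_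
  · exact (add_zero (Additive.ofMul a + Additive.ofMul b)).symm
  · change (0 : ZMod 2) = 0 + 0 + β.toFun (.ofMul a) (.ofMul b) + β.toFun (.ofMul a) (.ofMul b)
      + β.toFun _ 0
    rw [map_zero, add_zero, zero_add, zero_add, zmod_two_add_self]

/-- Multiplication by `⟨a⟩` on `ℤ ⊕ β.Ext`, a model of the Grothendieck–Witt group modulo the third
power of the fundamental ideal. -/
def scale (a : Fˣ) : AddMonoid.End (ℤ × β.Ext) :=
  AddMonoidHom.mk' (fun x => (x.1, x.1 • β.of a + x.2 + β.inr (β.toFun (.ofMul a) (β.fstHom x.2))))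
    (by
      intro x y
      refine Prod.ext rfl ?_
      simp only [Prod.fst_add, Prod.snd_add, map_add, add_smul]
      abel)

theorem scale_apply (a : Fˣ) (x : ℤ × β.Ext) : β.scale a x
    = (x.1, x.1 • β.of a + x.2 + β.inr (β.toFun (.ofMul a) (β.fstHom x.2))) := rfl

theorem scale_mul (a b : Fˣ) : β.scale (a * b) = β.scale a * β.scale b := by
  refine AddMonoidHom.ext fun x => ?_
  change β.scale (a * b) x = β.scale a (β.scale b x)
  simp only [scale_apply]
  refine Prod.ext rfl ?_
  have h : β.inr (x.1 • β.toFun (.ofMul a) (.ofMul b))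
      = x.1 • β.inr (β.toFun (.ofMul a) (.ofMul b)) := map_zsmul _ _ _
  simp only [map_add, map_zsmul, fstHom_of, fstHom_inr, of_mul, ofMul_mul, AddMonoidHom.add_apply,
    smul_add, map_zero, h]
  abel_nf

theorem scale_sub_one_mul_scale_sub_one (a b : Fˣ) (h : (b : F) = 1 - (a : F)) :
    (β.scale a - 1) * (β.scale b - 1) = 0 := by
  rw [sub_mul, mul_sub, ← scale_mul, one_mul, mul_one]
  refine AddMonoidHom.ext fun x => ?_
  change β.scale (a * b) x - β.scale a x - (β.scale b x - x) = 0
  simp only [scale_apply, of_mul, β.steinberg a b h, ofMul_mul, map_add, AddMonoidHom.add_apply,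
    smul_add, map_zero]
  refine Prod.ext ?_ ?_
  · simp
  · simp only [Prod.snd_sub, Prod.snd_zero]; abel_nf

/-- Multiplication by the hyperbolic plane. -/
def hyperbolic : AddMonoid.End (ℤ × β.Ext) := 1 + β.scale (-1)

theorem hyperbolic_mul_scale (a : Fˣ) : β.hyperbolic * β.scale a = β.scale a * β.hyperbolic := by
  rw [hyperbolic, add_mul, mul_add, ← scale_mul, ← scale_mul, one_mul, mul_one, mul_comm]

/-- The quotient of `ℤ ⊕ β.Ext` by the hyperbolic forms, a model of the Witt group modulo the third
power of the fundamental ideal. -/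
abbrev Witt : Type _ := (ℤ × β.Ext) ⧸ β.hyperbolic.range

/-- Multiplication by `⟨a⟩` on `β.Witt`. -/
def wittScale (a : Fˣ) : AddMonoid.End β.Witt :=
  QuotientAddGroup.map _ _ (β.scale a) (by
    rintro _ ⟨x, rfl⟩
    exact ⟨β.scale a x, DFunLike.congr_fun (β.hyperbolic_mul_scale a) x⟩)

theorem wittScale_mul (a b : Fˣ) : β.wittScale (a * b) = β.wittScale a * β.wittScale b := by
  refine AddMonoidHom.ext fun x => ?_
  induction x using QuotientAddGroup.induction_on with
  | H x =>
    change ((β.scale (a * b) x : ℤ × β.Ext) : β.Witt) = (β.scale a (β.scale b x) : ℤ × β.Ext)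
    rw [scale_mul]
    rfl

/-- The action of the Milnor–Witt ring on `β.Witt`, where `η` acts by `1` and `[a]` by `⟨a⟩ - 1`. -/
noncomputable def rep : KMW F →+* AddMonoid.End β.Witt :=
  lift (F := F) (fun a => β.wittScale a - 1) 1
    (by
      intro a b h
      refine AddMonoidHom.ext fun x => ?_
      induction x using QuotientAddGroup.induction_on with
      | H x =>
        exact congrArg (QuotientAddGroup.mk (s := β.hyperbolic.range))
          (DFunLike.congr_fun (β.scale_sub_one_mul_scale_sub_one a b h) x))
    (by
      intro a b
      rw [wittScale_mul]
      exact mul_sub_one_eq (β.wittScale a) (β.wittScale b))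
    (fun a => by rw [one_mul, mul_one])
    (by
      rw [mul_one, one_mul]
      refine AddMonoidHom.ext fun x => ?_
      induction x using QuotientAddGroup.induction_on with
      | H x =>
        have h1 : (2 + (β.wittScale (-1) - 1) : AddMonoid.End β.Witt)
            = 1 + β.wittScale (-1) := by rw [← one_add_one_eq_two]; abel
        rw [h1]
        exact (QuotientAddGroup.eq_zero_iff _).mpr ⟨x, rfl⟩)

theorem rep_symb (a : Fˣ) : β.rep (symb a) = β.wittScale a - 1 := by
  exact lift_symb ..

theorem rep_eta : β.rep (eta F) = 1 := by
  exact lift_eta ..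

theorem rep_pfister (a b : Fˣ) : β.rep (pfister a b) (((1 : ℤ), (0 : β.Ext)) : ℤ × β.Ext)
    = (((0 : ℤ), β.inr (β.toFun (.ofMul a) (.ofMul b))) : ℤ × β.Ext) := by
  rw [pfister, map_mul, map_mul, rep_eta, rep_symb, rep_symb, one_mul]
  change (((β.scale a (β.scale b (1, 0) - (1, 0)) - (β.scale b (1, 0) - (1, 0))) : ℤ × β.Ext) :
    β.Witt) = _
  simp [scale_apply, fstHom_of]

/-- A hyperbolic element of rank 0 is 2x + β(-1, v), with v the first component of x. Its `ZMod 2`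
component is β(-1, v) + β(v, v), which vanishes by `self`; so passing to the Witt quotient does not
destroy the symbol. -/
theorem inr_notMem_range {s : ZMod 2} (hs : s ≠ 0) :
    ((0 : ℤ), β.inr s) ∉ β.hyperbolic.range := by
  rintro ⟨⟨n, x⟩, hx⟩
  change ((n, x) : ℤ × β.Ext) + β.scale (-1) (n, x) = _ at hx
  rw [scale_apply, Prod.mk_add_mk, Prod.mk.injEq] at hx
  obtain ⟨hn, hx⟩ := hx
  obtain rfl : n = 0 := by omega
  rw [zero_smul, zero_add] at hx
  have h2 := congrArg SymbolExt.snd hx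
  change x.snd + (x.snd + β.toFun (.ofMul (-1)) x.fst + β.toFun x.fst 0)
    + β.toFun x.fst (x.fst + 0) = s at h2
  rw [map_zero, add_zero, add_zero, β.self, add_assoc, add_assoc, zmod_two_add_self, add_zero,
    zmod_two_add_self] at h2
  exact hs h2.symm

theorem pfister_ne_zero {a b : Fˣ} (h : β.toFun (.ofMul a) (.ofMul b) ≠ 0) : pfister a b ≠ 0 := by
  intro h0
  have h1 := β.rep_pfister a b
  rw [h0, map_zero] at h1
  exact β.inr_notMem_range h ((QuotientAddGroup.eq_zero_iff _).mp h1.symm)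

end SteinbergSymbol

end MilnorWitt

namespace MilnorWitt

/-! ### The norm residue symbol and the order of the kernel -/

section

variable {F : Type*} [Field F]

open Classical in
/-- The norm residue symbol: `0` if `b` is a value of `x ^ 2 - a * y ^ 2` and `1` otherwise. -/
noncomputable def normSymbol (a b : Fˣ) : ZMod 2 := if b ∈ normGroup a then 0 else 1

theorem normSymbol_of_mem {a b : Fˣ} (h : b ∈ normGroup a) : normSymbol a b = 0 := if_pos h

theorem normSymbol_of_notMem {a b : Fˣ} (h : b ∉ normGroup a) : normSymbol a b = 1 := if_neg h

theorem normSymbol_comm [NeZero (2 : F)] (a b : Fˣ) : normSymbol a b = normSymbol b a := by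
  by_cases h : b ∈ normGroup a
  · rw [normSymbol_of_mem h, normSymbol_of_mem (mem_normGroup_comm h)]
  · rw [normSymbol_of_notMem h, normSymbol_of_notMem fun h' => h (mem_normGroup_comm h')]

end

namespace NormIndexTwo

variable {F : Type*} [Field F] {Δ ϖ : Fˣ} (h : NormIndexTwo F Δ ϖ)
include h

theorem normSymbol_mul (a b c : Fˣ) :
    normSymbol a (b * c) = normSymbol a b + normSymbol a c := by
  by_cases hb : b ∈ normGroup a
  · by_cases hc : c ∈ normGroup a
    · rw [normSymbol_of_mem hb, normSymbol_of_mem hc, normSymbol_of_mem (Subgroup.mul_mem _ hb hc), add_zero]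
    · rw [normSymbol_of_mem hb, normSymbol_of_notMem hc, normSymbol_of_notMem
        (fun h' => hc ((Subgroup.mul_mem_cancel_left _ hb).mp h')), zero_add]
  · by_cases hc : c ∈ normGroup a
    · rw [normSymbol_of_notMem hb, normSymbol_of_mem hc, normSymbol_of_notMem
        (fun h' => hb ((Subgroup.mul_mem_cancel_right _ hc).mp h')), add_zero]
    · rw [normSymbol_of_notMem hb, normSymbol_of_notMem hc,
        normSymbol_of_mem (h.mul_mem a b c hb hc)]
      rfl

variable [NeZero (2 : F)]

/-- The norm residue symbol as a bilinear Steinberg symbol. -/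
noncomputable def symbol : SteinbergSymbol F where
  toFun := AddMonoidHom.mk' (fun a => AddMonoidHom.mk' (fun b => normSymbol a.toMul b.toMul)
      (fun b c => h.normSymbol_mul a.toMul b.toMul c.toMul))
    (fun a a' => by
      refine AddMonoidHom.ext fun b => ?_
      change normSymbol (a.toMul * a'.toMul) b.toMul
        = normSymbol a.toMul b.toMul + normSymbol a'.toMul b.toMul
      rw [normSymbol_comm, h.normSymbol_mul, normSymbol_comm, normSymbol_comm b.toMul])
  symm a b := normSymbol_comm _ _
  steinberg a b hab := normSymbol_of_mem ⟨1, 1, by simpa using hab⟩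
  self a := by
    change normSymbol a.toMul a.toMul = normSymbol (-1) a.toMul
    -- The relation β(a, a) = β(-1, a) is the expansion of β(a, -a) = 0.
    have h1 : normSymbol a.toMul (-1 * a.toMul) = 0 :=
      normSymbol_of_mem (by rw [neg_one_mul]; exact neg_self_mem_normGroup _)
    rw [h.normSymbol_mul] at h1
    rw [normSymbol_comm (-1)]
    exact (CharTwo.add_eq_zero.mp h1).symm

theorem pfister_ne_zero : K1.pfister Δ ϖ ≠ 0 := by
  intro h0
  refine h.symbol.pfister_ne_zero (a := Δ) (b := ϖ) ?_ (congrArg (K1.incl F) h0)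
  change normSymbol Δ ϖ ≠ 0
  rw [normSymbol_of_notMem h.notMem]
  exact one_ne_zero

theorem card_fiber (x : Additive Fˣ) : Nat.card (p F ⁻¹' {x}) = 2 := by
  obtain ⟨z, rfl⟩ := p_surjective F x
  have hset : p F ⁻¹' {p F z} = {z, z + K1.pfister Δ ϖ} := by
    ext w
    rw [Set.mem_preimage, Set.mem_singleton_iff, ← sub_eq_zero, ← map_sub, h.mem_ker_iff,
      sub_eq_zero, sub_eq_iff_eq_add', Set.mem_insert_iff, Set.mem_singleton_iff]
  rw [hset, Nat.card_coe_set_eq, Set.ncard_pair]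
  exact fun h' => h.pfister_ne_zero (left_eq_add.mp h')

end NormIndexTwo

end MilnorWitt

namespace MilnorWitt

/-! ### Finite fields -/

section FiniteField

variable {k : Type*} [Field k] [Finite k]

theorem mem_or_mem_or_add_mem_of_index_le_two {G : Type*} [AddCommGroup G] {H : AddSubgroup G}
    (h0 : H.index ≠ 0) (h : H.index ≤ 2) (x y : G) : x ∈ H ∨ y ∈ H ∨ x + y ∈ H := by
  have : H.index = 1 ∨ H.index = 2 := by omega
  rcases this with h1 | h1
  · rw [AddSubgroup.index_eq_one] at h1
    simp [h1]
  · rw [AddSubgroup.add_mem_iff_of_index_two h1]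
    tauto

/-- In characteristic 2 the map u ↦ bu² + cu is additive, and its kernel has at most two elements.
On a finite field its image therefore has index at most 2, so it contains one of x, y, x + y. -/
theorem exists_quadratic_eq [CharP k 2] (b : k) {c : k} (hc : c ≠ 0) (x y : k) :
    ∃ u, b * u ^ 2 + c * u = x ∨ b * u ^ 2 + c * u = y ∨ b * u ^ 2 + c * u = x + y := by
  let f : k →+ k := AddMonoidHom.mk' (fun u => b * u ^ 2 + c * u) fun u v => by
    rw [CharTwo.add_sq]; ring
  have hcard : Nat.card f.ker ≤ 2 := by
    have hsub : (f.ker : Set k) ⊆ {0, -(c / b)} := by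
      intro u hu
      have hu : b * u ^ 2 + c * u = 0 := hu
      by_cases h0 : u = 0
      · exact Or.inl h0
      · right
        have h1 : b * u + c = 0 := by
          have : u * (b * u + c) = 0 := by linear_combination hu
          exact (mul_eq_zero.mp this).resolve_left h0
        have hb : b ≠ 0 := by rintro rfl; simp at h1; exact hc h1
        change u = -(c / b)
        field_simp
        linear_combination h1
    have := Set.ncard_le_ncard hsub (Set.toFinite _)
    exact (Nat.card_coe_set_eq _).trans_le (this.trans ((Set.ncard_insert_le _ _).trans (by simp)))
  have hidx : f.range.index = Nat.card f.ker := by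
    have h1 := AddSubgroup.card_mul_index f.ker
    have h2 := AddSubgroup.card_mul_index f.range
    rw [AddSubgroup.index_ker] at h1
    have h3 : 0 < Nat.card f.range := Nat.card_pos
    rw [← h1, mul_comm] at h2
    exact Nat.eq_of_mul_eq_mul_right h3 h2
  rcases mem_or_mem_or_add_mem_of_index_le_two (H := f.range) (hidx ▸ Nat.card_pos.ne')
    (hidx ▸ hcard) x y with ⟨u, h⟩ | ⟨u, h⟩ | ⟨u, h⟩
  · exact ⟨u, Or.inl h⟩
  · exact ⟨u, Or.inr (Or.inl h)⟩
  · exact ⟨u, Or.inr (Or.inr h)⟩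

theorem isSquare_or_isSquare_or_isSquare_mul (x y : k) :
    IsSquare x ∨ IsSquare y ∨ IsSquare (x * y) := by
  classical
  have := Fintype.ofFinite k
  by_cases hk : ringChar k = 2
  · exact Or.inl (FiniteField.isSquare_of_char_two hk x)
  by_contra! h
  obtain ⟨h1, h2, h3⟩ := h
  rw [← quadraticChar_neg_one_iff_not_isSquare] at h1 h2 h3
  rw [map_mul, h1, h2] at h3
  norm_num at h3

theorem exists_sq_sub_mul_sq_eq (h2 : (2 : k) ≠ 0) {a : k} (ha : a ≠ 0) (c : k) :
    ∃ x y, x ^ 2 - a * y ^ 2 = c := by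
  have := Fintype.ofFinite k
  open Polynomial in
  obtain ⟨x, y, h⟩ := FiniteField.exists_root_sum_quadratic (R := k) (f := X ^ 2 - C c)
    (g := C (-a) * X ^ 2) (degree_X_pow_sub_C (by decide) _)
    (degree_C_mul_X_pow 2 (neg_ne_zero.mpr ha))
    (FiniteField.odd_card_of_char_ne_two (fun h => h2 (by
      have := ringChar.Nat.cast_ringChar (R := k)
      rw [h] at this
      exact_mod_cast this)))
  refine ⟨x, y, ?_⟩
  simp at h
  linear_combination h

/-- The map t ↦ t² + t takes the same value at 0 and -1, so it is not surjective. The resulting r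
gives a quadratic polynomial without roots in every characteristic, 2 included. -/
theorem exists_forall_sq_add_ne (k : Type*) [Field k] [Finite k] : ∃ r : k, ∀ t, t ^ 2 + t ≠ r := by
  by_contra! h
  have hinj : Function.Injective (fun t : k => t ^ 2 + t) :=
    Finite.injective_iff_surjective.mpr h
  have : (0 : k) = -1 := hinj (by simp)
  simp at this

end FiniteField

/-! ### Filtrations of unit groups -/

section Filtration

variable {R : Type*} [CommRing R]

/-- Units congruent to `1` modulo `π ^ i` are, up to elements of `S`, congruent to `1` modulo
`π ^ (i + 1)`. -/
def Improves (π : R) (S : Subgroup Rˣ) (i : ℕ) : Prop :=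
  ∀ g : Rˣ, π ^ i ∣ (g : R) - 1 → ∃ s ∈ S, π ^ (i + 1) ∣ ((g * s : Rˣ) : R) - 1

/-- Of two units congruent to `1` modulo `π ^ i` and their product one is, up to elements of `S`,
congruent to `1` modulo `π ^ (i + 1)`. -/
def HalfImproves (π : R) (S : Subgroup Rˣ) (i : ℕ) : Prop :=
  ∀ g g' : Rˣ, π ^ i ∣ (g : R) - 1 → π ^ i ∣ (g' : R) - 1 →
    ∃ s ∈ S, π ^ (i + 1) ∣ ((g * s : Rˣ) : R) - 1 ∨ π ^ (i + 1) ∣ ((g' * s : Rˣ) : R) - 1 ∨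
      π ^ (i + 1) ∣ ((g * g' * s : Rˣ) : R) - 1

variable {π : R} {S T : Subgroup Rˣ}

theorem Improves.mono {i : ℕ} (h : Improves π S i) (hST : S ≤ T) : Improves π T i := fun g hg =>
  let ⟨s, hs, h'⟩ := h g hg
  ⟨s, hST hs, h'⟩

/-- Successive approximation. It stops after finitely many steps because level `M` already lies in
S, so no limit is taken. -/
theorem mem_of_improves {n M : ℕ} (h : ∀ i, n ≤ i → i < M → Improves π S i)
    (hM : ∀ g : Rˣ, π ^ M ∣ (g : R) - 1 → g ∈ S) (g : Rˣ) (hg : π ^ n ∣ (g : R) - 1) : g ∈ S := by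
  rcases le_total M n with hMn | hnM
  · exact hM g ((pow_dvd_pow π hMn).trans hg)
  · induction hnM using Nat.decreasingInduction generalizing g with
    | self => exact hM g hg
    | of_succ n hn ih =>
      obtain ⟨s, hs, hgs⟩ := h n le_rfl hn g hg
      exact (S.mul_mem_cancel_right hs).mp
        (ih (fun i hi hiM => h i (by omega) hiM) _ hgs)

/-- The conclusion says that S has index at most 2. The index of S is bounded by the product of its
indices on the graded pieces, which are trivial except at the critical level t. -/
theorem mem_or_mem_or_mul_mem_of_improves {t M : ℕ} (h : ∀ i, i ≠ t → Improves π S i)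
    (ht : HalfImproves π S t) (hM : ∀ g : Rˣ, π ^ M ∣ (g : R) - 1 → g ∈ S) (g g' : Rˣ) :
    g ∈ S ∨ g' ∈ S ∨ g * g' ∈ S := by
  have hbig (g : Rˣ) (hg : π ^ (t + 1) ∣ (g : R) - 1) : g ∈ S :=
    mem_of_improves (fun i hi _ => h i (by omega)) hM g hg
  suffices ∀ n ≤ t, ∀ g g' : Rˣ, π ^ n ∣ (g : R) - 1 → π ^ n ∣ (g' : R) - 1 →
      g ∈ S ∨ g' ∈ S ∨ g * g' ∈ S from this 0 (Nat.zero_le _) g g' (by simp) (by simp)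
  intro n hn
  induction hn using Nat.decreasingInduction with
  | self =>
    intro g g' hg hg'
    obtain ⟨s, hs, h1⟩ := ht g g' hg hg'
    exact h1.imp (fun h1 => (S.mul_mem_cancel_right hs).mp (hbig _ h1))
      (Or.imp (fun h1 => (S.mul_mem_cancel_right hs).mp (hbig _ h1))
        (fun h1 => (S.mul_mem_cancel_right hs).mp (hbig _ h1)))
  | of_succ n hn ih =>
    intro g g' hg hg'
    obtain ⟨s, hs, h1⟩ := h n hn.ne g hg
    obtain ⟨s', hs', h1'⟩ := h n hn.ne g' hg'
    refine (ih _ _ h1 h1').imp (S.mul_mem_cancel_right hs).mp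
      (Or.imp (S.mul_mem_cancel_right hs').mp fun h2 => ?_)
    rw [mul_mul_mul_comm] at h2
    exact (S.mul_mem_cancel_right (S.mul_mem hs hs')).mp h2

theorem isUnit_one_add_mul [IsLocalRing R] (hπ : ¬IsUnit π) (x : R) : IsUnit (1 + π * x) := by
  have h : π * x ∈ IsLocalRing.maximalIdeal R :=
    Ideal.mul_mem_right _ _ ((IsLocalRing.mem_maximalIdeal _).mpr hπ)
  by_contra h'
  have := Ideal.sub_mem _ ((IsLocalRing.mem_maximalIdeal _).mpr h') h
  rw [add_sub_cancel_right] at this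
  exact (Ideal.ne_top_iff_one _).mp (IsLocalRing.maximalIdeal.isMaximal R).ne_top this

end Filtration

end MilnorWitt

namespace MilnorWitt

open IsLocalRing

/-! ### Squares in the unit filtration, with 2 of valuation e (possibly 0) -/

section DVR

variable {R : Type*} [CommRing R] [IsDomain R] [IsDiscreteValuationRing R]
  {π : R} (hπ : Irreducible π)

/-- The squares of units. -/
abbrev sqUnits (R : Type*) [CommRing R] : Subgroup Rˣ := (powMonoidHom 2).range

include hπ in
theorem residue_eq_zero_iff_dvd (r : R) : residue R r = 0 ↔ π ∣ r := by
  rw [residue_eq_zero_iff, hπ.maximalIdeal_eq, Ideal.mem_span_singleton]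

include hπ in
theorem residue_eq_iff_dvd (r s : R) : residue R r = residue R s ↔ π ∣ r - s := by
  rw [← sub_eq_zero, ← map_sub, residue_eq_zero_iff_dvd hπ]

include hπ in
theorem isUnit_iff_not_dvd (r : R) : IsUnit r ↔ ¬π ∣ r := by
  rw [← residue_ne_zero_iff_isUnit, ne_eq, residue_eq_zero_iff_dvd hπ]

include hπ in
theorem isUnit_one_add_pow_mul {i : ℕ} (hi : 0 < i) (x : R) : IsUnit (1 + π ^ i * x) := by
  obtain ⟨i, rfl⟩ := Nat.exists_eq_succ_of_ne_zero hi.ne'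
  rw [pow_succ', mul_assoc]
  exact isUnit_one_add_mul hπ.not_isUnit _

variable {ε : Rˣ} {e : ℕ} (h2 : (2 : R) = ε * π ^ e)
include hπ h2

theorem charP_residueField (he : 0 < e) : CharP (ResidueField R) 2 := by
  refine CharTwo.of_one_ne_zero_of_two_eq_zero one_ne_zero ?_
  have : residue R 2 = 0 := by
    rw [residue_eq_zero_iff_dvd hπ, h2]
    exact Dvd.dvd.mul_left (dvd_pow_self _ he.ne') _
  rwa [map_ofNat] at this

omit hπ in
theorem two_ne_zero_residueField (he : e = 0) : (2 : ResidueField R) ≠ 0 := by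
  have : residue R 2 ≠ 0 := by
    rw [residue_ne_zero_iff_isUnit, h2, he, pow_zero, mul_one]
    exact ε.isUnit
  rwa [map_ofNat] at this

/-- Multiply 1 + π^i r by (1 - π^(i-e) ε⁻¹ r)². The linear term cancels π^i r, and the quadratic
term has level 2(i-e) > i. -/
theorem improves_sqUnits_of_gt {i : ℕ} (hi : 2 * e < i) : Improves π (sqUnits R) i := by
  obtain ⟨j, rfl⟩ : ∃ j, i = 2 * e + 1 + j := ⟨i - (2 * e + 1), by omega⟩
  rintro g ⟨r, hr⟩
  have hg : (g : R) = 1 + π ^ (2 * e + 1 + j) * r := by rw [← hr]; ring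
  have hu : IsUnit (1 + π ^ (e + 1 + j) * (-((ε⁻¹ : Rˣ) : R) * r)) :=
    isUnit_one_add_pow_mul hπ (by omega) _
  refine ⟨hu.unit ^ 2, ⟨hu.unit, rfl⟩, ?_⟩
  rw [Units.val_mul, Units.val_pow_eq_pow_val, IsUnit.unit_spec, hg]
  have hε : (ε : R) * ((ε⁻¹ : Rˣ) : R) = 1 := ε.mul_inv
  set δ : R := ((ε⁻¹ : Rˣ) : R)
  refine ⟨-(π ^ (2 * e + j) * r ^ 2) + (1 + π ^ (2 * e + 1 + j) * r) * (π ^ j * δ ^ 2 * r ^ 2), ?_⟩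
  have key : (1 + π ^ (e + 1 + j) * (-δ * r)) ^ 2
      = 1 - π ^ (2 * e + 1 + j) * r + π ^ (2 * e + 2 + 2 * j) * δ ^ 2 * r ^ 2 := by
    linear_combination (-(π ^ (e + 1 + j) * δ * r)) * h2 - π ^ (2 * e + 1 + j) * r * hε
  rw [key]
  ring

variable [Finite (ResidueField R)]

theorem exists_dvd_sq_sub (he : 0 < e) (r : R) : ∃ u, π ∣ u ^ 2 - r := by
  have := charP_residueField hπ h2 he
  have := Fintype.ofFinite (ResidueField R)
  obtain ⟨u, hu⟩ := FiniteField.isSquare_of_char_two (ringChar.eq _ 2) (residue R r)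
  obtain ⟨u, rfl⟩ := residue_surjective u
  refine ⟨u, ?_⟩
  rw [← residue_eq_iff_dvd hπ, map_pow, hu, pow_two]

theorem improves_sqUnits_zero (he : 0 < e) : Improves π (sqUnits R) 0 := by
  intro g _
  obtain ⟨u, hu⟩ := exists_dvd_sq_sub hπ h2 he ((g⁻¹ : Rˣ) : R)
  have hu' : IsUnit u := by
    rw [isUnit_iff_not_dvd hπ]
    intro h
    refine (isUnit_iff_not_dvd hπ _).mp g⁻¹.isUnit ?_
    have := dvd_sub (h.mul_left u) hu
    rwa [← pow_two, sub_sub_cancel] at this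
  refine ⟨hu'.unit ^ 2, ⟨hu'.unit, rfl⟩, ?_⟩
  rw [Units.val_mul, Units.val_pow_eq_pow_val, IsUnit.unit_spec, zero_add, pow_one]
  have h := hu.mul_left (g : R)
  rwa [mul_sub, Units.mul_inv] at h

/-- The residue field is perfect of characteristic 2, so r ≡ u² mod π. In (1 + π^j u)² the cross
term has level at least e + j > 2j, and r + u² ≡ 2r ≡ 0. -/
theorem improves_sqUnits_even {j : ℕ} (hj : j < e) : Improves π (sqUnits R) (2 * j) := by
  rcases Nat.eq_zero_or_pos j with rfl | hj0
  · exact improves_sqUnits_zero hπ h2 hj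
  rintro g ⟨r, hr⟩
  have hg : (g : R) = 1 + π ^ (2 * j) * r := by rw [← hr]; ring
  obtain ⟨u, w, hu⟩ := exists_dvd_sq_sub hπ h2 (by omega) r
  obtain ⟨f, rfl⟩ : ∃ f, e = j + 1 + f := ⟨e - (j + 1), by omega⟩
  -- Positivity of j puts the product term of level 4j beyond level 2j; this is why j = 0 is treated
  -- apart.
  obtain ⟨i, rfl⟩ : ∃ i, j = i + 1 := ⟨j - 1, by omega⟩
  have hun : IsUnit (1 + π ^ (i + 1) * u) := isUnit_one_add_pow_mul hπ (by omega) _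
  refine ⟨hun.unit ^ 2, ⟨hun.unit, rfl⟩, ?_⟩
  rw [Units.val_mul, Units.val_pow_eq_pow_val, IsUnit.unit_spec, hg]
  have key : (1 + π ^ (2 * (i + 1)) * r) * (1 + π ^ (i + 1) * u) ^ 2 - 1
      = π ^ (2 * (i + 1) + 1) * (ε * π ^ (i + 1 + f) * r + w
        + (1 + π ^ (2 * (i + 1)) * r) * ε * π ^ f * u
        + π ^ (2 * i + 1) * r * u ^ 2) := by
    linear_combination (π ^ (2 * (i + 1))) * hu + (π ^ (2 * (i + 1)) * r
      + π ^ (i + 1) * u * (1 + π ^ (2 * (i + 1)) * r)) * h2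
  rw [key]
  exact dvd_mul_right _ _

omit h2 in
theorem halfImproves_sqUnits_zero : HalfImproves π (sqUnits R) 0 := by
  intro g g' _ _
  have key (x : Rˣ) (hx : IsSquare (residue R (x : R))) :
      ∃ s ∈ sqUnits R, π ^ (0 + 1) ∣ ((x * s : Rˣ) : R) - 1 := by
    obtain ⟨u, hu⟩ := hx
    obtain ⟨u, rfl⟩ := residue_surjective u
    have hu' : IsUnit u := by
      rw [← residue_ne_zero_iff_isUnit]
      intro h0
      rw [h0, mul_zero] at hu
      exact (residue_ne_zero_iff_isUnit _).mpr x.isUnit hu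
    refine ⟨hu'.unit⁻¹ ^ 2, ⟨hu'.unit⁻¹, rfl⟩, ?_⟩
    rw [zero_add, pow_one, ← residue_eq_iff_dvd hπ, map_one]
    have h1 : residue R (x * ((hu'.unit⁻¹ : Rˣ) : R) ^ 2)
        = (residue R (u * ((hu'.unit⁻¹ : Rˣ) : R))) ^ 2 := by
      rw [map_mul, hu, map_pow, map_mul]; ring
    rw [Units.val_mul, Units.val_pow_eq_pow_val, h1, IsUnit.mul_val_inv, map_one, one_pow]
  rcases isSquare_or_isSquare_or_isSquare_mul (residue R (g : R)) (residue R (g' : R))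
    with h | h | h
  · obtain ⟨s, hs, h⟩ := key g h
    exact ⟨s, hs, Or.inl h⟩
  · obtain ⟨s, hs, h⟩ := key g' h
    exact ⟨s, hs, Or.inr (Or.inl h)⟩
  · rw [← map_mul, ← Units.val_mul] at h
    obtain ⟨s, hs, h⟩ := key (g * g') h
    exact ⟨s, hs, Or.inr (Or.inr h)⟩

omit h2 in
/-- If `S` contains the units `1 + π ^ t * (b * u ^ 2 + c * u)` up to higher powers of `π`, then it
contains half of the units of level `t`. -/
theorem halfImproves_of_quadratic [CharP (ResidueField R) 2] {S : Subgroup Rˣ} {t : ℕ} (ht : 0 < t)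
    (b : R) {c : R} (hc : IsUnit c)
    (hS : ∀ u : R, ∃ s ∈ S, ((s : Rˣ) : R) = 1 + π ^ t * (b * u ^ 2 + c * u)) :
    HalfImproves π S t := by
  rintro g g' ⟨r, hr⟩ ⟨r', hr'⟩
  have hg : (g : R) = 1 + π ^ t * r := by rw [← hr]; ring
  have hg' : (g' : R) = 1 + π ^ t * r' := by rw [← hr']; ring
  obtain ⟨i, rfl⟩ : ∃ i, t = i + 1 := ⟨t - 1, by omega⟩
  have key (x : Rˣ) (q u : R) (hx : (x : R) = 1 + π ^ (i + 1) * q)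
      (hu : residue R b * residue R u ^ 2 + residue R c * residue R u = residue R q) :
      ∃ s ∈ S, π ^ (i + 1 + 1) ∣ ((x * s : Rˣ) : R) - 1 := by
    obtain ⟨s, hs, hsu⟩ := hS u
    refine ⟨s, hs, ?_⟩
    rw [← map_pow, ← map_mul, ← map_mul, ← map_add, ← CharTwo.neg_eq (residue R q), ← map_neg,
      residue_eq_iff_dvd hπ] at hu
    obtain ⟨w, hw⟩ := hu
    refine ⟨w + π ^ i * q * (b * u ^ 2 + c * u), ?_⟩
    rw [Units.val_mul, hx, hsu]
    linear_combination π ^ (i + 1) * hw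
  obtain ⟨u, hu⟩ := exists_quadratic_eq (residue R b) ((residue_ne_zero_iff_isUnit c).mpr hc)
    (residue R r) (residue R r')
  obtain ⟨u, rfl⟩ := residue_surjective u
  rcases hu with hu | hu | hu
  · obtain ⟨s, hs, h⟩ := key g r u hg hu
    exact ⟨s, hs, Or.inl h⟩
  · obtain ⟨s, hs, h⟩ := key g' r' u hg' hu
    exact ⟨s, hs, Or.inr (Or.inl h)⟩
  · obtain ⟨s, hs, h⟩ := key (g * g') (r + r' + π ^ (i + 1) * r * r') u
      (by rw [Units.val_mul, hg, hg']; ring)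
      (by
        rw [hu, ← map_add, residue_eq_iff_dvd hπ]
        exact ⟨-(π ^ i * r * r'), by ring⟩)
    exact ⟨s, hs, Or.inr (Or.inr h)⟩

/-- Up to squares of units, a unit is `1 + 4 * ρ` or `1 + δ * π ^ (2 * m + 1)` with a unit `δ` and
`2 * m + 1` less than the valuation of `4`. -/
theorem exists_unit_normal_form (u : Rˣ) :
    ∃ s : Rˣ, (∃ ρ : R, ((s ^ 2 * u : Rˣ) : R) = 1 + 4 * ρ) ∨
      ∃ (m : ℕ) (δ : Rˣ), 2 * m + 1 < 2 * e ∧ ((s ^ 2 * u : Rˣ) : R) = 1 + δ * π ^ (2 * m + 1) := by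
  by_contra! h
  have step (i : ℕ) (hi : i ≤ 2 * e) : ∃ s : Rˣ, π ^ i ∣ ((s ^ 2 * u : Rˣ) : R) - 1 := by
    induction i with
    | zero => exact ⟨1, by simp⟩
    | succ i ih =>
      obtain ⟨s, hs⟩ := ih (by omega)
      -- Even levels below 2e are absorbed by squares. At an odd level a unit coefficient would be
      -- the second normal form, which is excluded, so the level rises.
      rcases Nat.even_or_odd' i with ⟨j, rfl | rfl⟩
      · obtain ⟨_, ⟨s', rfl⟩, hs'⟩ := improves_sqUnits_even hπ h2 (by omega) _ hs
        refine ⟨s * s', ?_⟩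
        have : (s * s') ^ 2 * u = s ^ 2 * u * powMonoidHom 2 s' := by
          rw [powMonoidHom_apply, mul_pow]; exact mul_right_comm _ _ _
        rwa [this]
      · obtain ⟨r, hr⟩ := hs
        by_cases hrπ : π ∣ r
        · obtain ⟨r, rfl⟩ := hrπ
          exact ⟨s, r, by rw [hr]; ring⟩
        · have hru := (isUnit_iff_not_dvd hπ r).mpr hrπ
          refine absurd ?_ ((h s).2 j hru.unit (by omega))
          rw [IsUnit.unit_spec]
          linear_combination hr
  obtain ⟨s, r, hr⟩ := step (2 * e) le_rfl
  refine (h s).1 (((ε⁻¹ : Rˣ) : R) ^ 2 * r) ?_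
  have hε : (ε : R) * ((ε⁻¹ : Rˣ) : R) = 1 := ε.mul_inv
  set δ : R := ((ε⁻¹ : Rˣ) : R)
  have h4 : (4 : R) = ε ^ 2 * π ^ (2 * e) := by
    linear_combination (2 + (ε : R) * π ^ e) * h2
  rw [h4]
  linear_combination hr - π ^ (2 * e) * r * ((ε : R) * δ + 1) * hε

end DVR

end MilnorWitt

namespace MilnorWitt

open IsLocalRing

/-! ### Norm groups of a local field have index at most two -/

section UnitNorms

variable {R K : Type*} [CommRing R] [IsDomain R] [IsDiscreteValuationRing R] [Field K]
  [Algebra R K] [IsFractionRing R K]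

/-- The inclusion of the units of the valuation ring. -/
def unitsIncl (R K : Type*) [CommRing R] [Field K] [Algebra R K] : Rˣ →* Kˣ :=
  Units.map (algebraMap R K : R →* K)

omit [IsDomain R] [IsDiscreteValuationRing R] [IsFractionRing R K] in
theorem coe_unitsIncl (u : Rˣ) : (unitsIncl R K u : K) = algebraMap R K u := rfl

/-- The units of the valuation ring that are values of `x ^ 2 - a * y ^ 2`. -/
def unitNorms (R : Type*) {K : Type*} [CommRing R] [Field K] [Algebra R K] (a : Kˣ) :
    Subgroup Rˣ :=
  (normGroup a).comap (unitsIncl R K)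

omit [IsDomain R] [IsDiscreteValuationRing R] [IsFractionRing R K] in
theorem sqUnits_le_unitNorms (a : Kˣ) : sqUnits R ≤ unitNorms R a := by
  rintro _ ⟨u, rfl⟩
  change unitsIncl R K (u ^ 2) ∈ normGroup a
  rw [map_pow]
  exact sq_mem_normGroup _ _

variable {π : R} (hπ : Irreducible π)

/-- A uniformizer as a unit of the field. -/
noncomputable def uniformizer (K : Type*) [Field K] [Algebra R K] [IsFractionRing R K]
    (hπ : Irreducible π) : Kˣ :=
  Units.mk0 (algebraMap R K π) (by simpa using hπ.ne_zero)

omit [IsDomain R] [IsDiscreteValuationRing R] in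
theorem coe_uniformizer : (uniformizer K hπ : K) = algebraMap R K π := rfl

theorem exists_eq_unit_mul_zpow (x : Kˣ) :
    ∃ (n : ℤ) (u : Rˣ), x = unitsIncl R K u * uniformizer K hπ ^ n := by
  obtain ⟨⟨n, u⟩, h⟩ := exists_decomposition hπ x
  exact ⟨n, u, Units.ext (by rw [h]; simp [coe_unitsIncl, coe_uniformizer])⟩

/-- A norm of odd valuation, together with the squares, supplies norms of every valuation. The index
question then reduces to units; this is the ramified case. -/
theorem exists_eq_unit_mul_mem {a c : Kˣ} (hc : c ∈ normGroup a) {w : Rˣ} {m : ℤ}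
    (hcw : c = unitsIncl R K w * uniformizer K hπ ^ (2 * m + 1)) (x : Kˣ) :
    ∃ u : Rˣ, ∃ y ∈ normGroup a, x = unitsIncl R K u * y := by
  obtain ⟨n, u, rfl⟩ := exists_eq_unit_mul_zpow hπ x
  rcases Int.even_or_odd' n with ⟨l, rfl | rfl⟩
  · refine ⟨u, _, ?_, rfl⟩
    rw [mul_comm 2 l, zpow_mul]
    exact_mod_cast sq_mem_normGroup a (uniformizer K hπ ^ l)
  · refine ⟨u * w⁻¹, (uniformizer K hπ ^ (l - m)) ^ 2 * c, sq_mul_mem_normGroup.mpr hc, ?_⟩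
    rw [hcw, map_mul, map_inv, ← zpow_natCast, ← zpow_mul, mul_comm _ (unitsIncl R K w * _),
      mul_assoc (unitsIncl R K w), ← zpow_add, mul_assoc, inv_mul_cancel_left]
    congr 2
    push_cast; ring

theorem mul_mem_of_units {a c : Kˣ} (hc : c ∈ normGroup a) {w : Rˣ} {m : ℤ}
    (hcw : c = unitsIncl R K w * uniformizer K hπ ^ (2 * m + 1))
    (h : ∀ g g' : Rˣ, g ∈ unitNorms R a ∨ g' ∈ unitNorms R a ∨ g * g' ∈ unitNorms R a)
    (x y : Kˣ) (hx : x ∉ normGroup a) (hy : y ∉ normGroup a) : x * y ∈ normGroup a := by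
  obtain ⟨u, x', hx', rfl⟩ := exists_eq_unit_mul_mem hπ hc hcw x
  obtain ⟨v, y', hy', rfl⟩ := exists_eq_unit_mul_mem hπ hc hcw y
  rw [Subgroup.mul_mem_cancel_right _ hx'] at hx
  rw [Subgroup.mul_mem_cancel_right _ hy'] at hy
  have h1 : unitsIncl R K (u * v) ∈ normGroup a := ((h u v).resolve_left hx).resolve_left hy
  rw [mul_mul_mul_comm, ← map_mul]
  exact Subgroup.mul_mem _ h1 (Subgroup.mul_mem _ hx' hy')

omit [IsDomain R] [IsDiscreteValuationRing R] in
theorem mem_normGroup_of_even {a : Kˣ} (h : ∀ u : Rˣ, u ∈ unitNorms R a) (u : Rˣ) (l : ℤ) :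
    unitsIncl R K u * uniformizer K hπ ^ (2 * l) ∈ normGroup a := by
  rw [mul_comm 2 l, zpow_mul]
  exact Subgroup.mul_mem _ (h u) (by exact_mod_cast sq_mem_normGroup a (uniformizer K hπ ^ l))

include hπ in
-- Unramified case: if all units are norms, so is every element of even valuation, and two elements
-- of odd valuation have a product of even valuation.
theorem mul_mem_of_forall_unit_mem {a : Kˣ} (h : ∀ u : Rˣ, u ∈ unitNorms R a) (x y : Kˣ)
    (hx : x ∉ normGroup a) (hy : y ∉ normGroup a) : x * y ∈ normGroup a := by
  obtain ⟨n, u, rfl⟩ := exists_eq_unit_mul_zpow hπ x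
  obtain ⟨m, v, rfl⟩ := exists_eq_unit_mul_zpow hπ y
  rcases Int.even_or_odd' n with ⟨l, rfl | rfl⟩
  · exact absurd (mem_normGroup_of_even hπ h _ _) hx
  rcases Int.even_or_odd' m with ⟨l', rfl | rfl⟩
  · exact absurd (mem_normGroup_of_even hπ h _ _) hy
  rw [mul_mul_mul_comm, ← map_mul, ← zpow_add,
    show 2 * l + 1 + (2 * l' + 1) = 2 * (l + l' + 1) by ring]
  exact mem_normGroup_of_even hπ h _ _

variable {ε : Rˣ} {e : ℕ} (h2 : (2 : R) = ε * π ^ e) [Finite (ResidueField R)] {M : ℕ}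
  (hM : ∀ g : Rˣ, π ^ M ∣ (g : R) - 1 → g ∈ sqUnits R)
include hπ h2 hM

/-- Here -π is a norm of odd valuation. Squares fill the even levels below 2e and all levels above
2e; the norms 1 - π(π^j u)² fill the odd levels below 2e. The critical level is 2e. -/
theorem mul_mem_normGroup_uniformizer (x y : Kˣ) (hx : x ∉ normGroup (uniformizer K hπ))
    (hy : y ∉ normGroup (uniformizer K hπ)) : x * y ∈ normGroup (uniformizer K hπ) := by
  have hsq := sqUnits_le_unitNorms (R := R) (uniformizer K hπ)
  refine mul_mem_of_units hπ (neg_self_mem_normGroup _) (w := -1) (m := 0)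
    (by ext; simp [coe_unitsIncl]) ?_ x y hx hy
  refine mem_or_mem_or_mul_mem_of_improves (π := π) (t := 2 * e) ?_ ?_ fun g hg => hsq (hM g hg)
  · intro i hi
    rcases lt_or_gt_of_ne hi with hi | hi
    · rcases Nat.even_or_odd' i with ⟨j, rfl | rfl⟩
      · exact (improves_sqUnits_even hπ h2 (by omega)).mono hsq
      · rintro g ⟨r, hr⟩
        have hg : (g : R) = 1 + π ^ (2 * j + 1) * r := by rw [← hr]; ring
        obtain ⟨u, w, hu⟩ := exists_dvd_sq_sub hπ h2 (by omega) r
        have hun : IsUnit (1 + π ^ (2 * j + 1) * (-u ^ 2)) :=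
          isUnit_one_add_pow_mul hπ (by omega) _
        refine ⟨hun.unit, ⟨1, algebraMap R K (π ^ j * u), ?_⟩, ?_⟩
        · rw [coe_unitsIncl, coe_uniformizer, IsUnit.unit_spec]
          simp only [map_add, map_mul, map_neg, map_pow, map_one]
          ring
        · rw [Units.val_mul, IsUnit.unit_spec, hg]
          refine ⟨-w - π ^ (2 * j) * r * u ^ 2, ?_⟩
          linear_combination -π ^ (2 * j + 1) * hu
    · exact (improves_sqUnits_of_gt hπ h2 hi).mono hsq
  · rcases Nat.eq_zero_or_pos e with rfl | he
    · intro g g' hg hg'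
      obtain ⟨s, hs, h⟩ := halfImproves_sqUnits_zero hπ g g' hg hg'
      exact ⟨s, hsq hs, h⟩
    · have := charP_residueField hπ h2 he
      -- At level 2e both terms count: (1 + π^e u)² = 1 + π^(2e)(u² + εu).
      refine halfImproves_of_quadratic hπ (by omega) 1 ε.isUnit fun u => ?_
      have hun := isUnit_one_add_pow_mul hπ he u
      refine ⟨hun.unit ^ 2, hsq ⟨hun.unit, rfl⟩, ?_⟩
      rw [Units.val_pow_eq_pow_val, IsUnit.unit_spec]
      linear_combination (π ^ e * u) * h2

/-- The norm of odd valuation is 1 - α = -δπ^(2m+1). The norms (1+y)² - αy² = 1 + 2y - δπ^(2m+1)y²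
with y = uπ^(q-m) have a linear term of level f+1+q and a quadratic one of level 2q+1, where f =
e-m-1. The two meet at q = f, so the critical level is 2f+1; the quadratic term dominates at odd
levels below it, the linear one above. -/
theorem mul_mem_normGroup_of_odd_defect {α δ : Rˣ} {m : ℕ} (hm : 2 * m + 1 < 2 * e)
    (hα : (α : R) = 1 + δ * π ^ (2 * m + 1)) (x y : Kˣ)
    (hx : x ∉ normGroup (unitsIncl R K α)) (hy : y ∉ normGroup (unitsIncl R K α)) :
    x * y ∈ normGroup (unitsIncl R K α) := by
  have hsq := sqUnits_le_unitNorms (R := R) (unitsIncl R K α)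
  obtain ⟨f, rfl⟩ : ∃ f, e = m + 1 + f := ⟨e - (m + 1), by omega⟩
  have hchar := charP_residueField hπ h2 (by omega)
  have hP : algebraMap R K π ≠ 0 := (uniformizer K hπ).ne_zero
  have h2K := congrArg (algebraMap R K) h2
  have hαK := congrArg (algebraMap R K) hα
  simp only [map_ofNat, map_mul, map_pow, map_add, map_one] at h2K hαK
  have hnorm (q : ℕ) (u : R) (s : Rˣ)
      (hs : (s : R) = 1 + ε * u * π ^ (f + 1 + q) - δ * u ^ 2 * π ^ (2 * q + 1)) :
      s ∈ unitNorms R (unitsIncl R K α) := by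
    have hsK := congrArg (algebraMap R K) hs
    simp only [map_mul, map_pow, map_add, map_one, map_sub] at hsK
    -- The coordinates may be non-integral, since q < m is allowed; only the value has to be a unit.
    refine ⟨1 + algebraMap R K u * algebraMap R K π ^ q / algebraMap R K π ^ m,
      algebraMap R K u * algebraMap R K π ^ q / algebraMap R K π ^ m, ?_⟩
    rw [coe_unitsIncl, coe_unitsIncl, hsK, hαK]
    field_simp
    linear_combination (-(algebraMap R K u) * algebraMap R K π ^ (q + m)) * h2K
  refine mul_mem_of_units hπ (c := unitsIncl R K (-δ) * uniformizer K hπ ^ (2 * (m : ℤ) + 1))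
    ⟨1, 1, ?_⟩ rfl ?_ x y hx hy
  · rw [coe_unitsIncl, hαK]
    have : (uniformizer K hπ : K) ^ (2 * (m : ℤ) + 1) = algebraMap R K π ^ (2 * m + 1) := by
      rw [coe_uniformizer]; exact_mod_cast zpow_natCast (algebraMap R K π) (2 * m + 1)
    rw [Units.val_mul, Units.val_zpow_eq_zpow_val, this, coe_unitsIncl]
    simp
  refine mem_or_mem_or_mul_mem_of_improves (π := π) (t := 2 * f + 1) ?_ ?_
    fun g hg => hsq (hM g hg)
  · intro i hi
    rcases lt_or_gt_of_ne hi with hi | hi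
    · rcases Nat.even_or_odd' i with ⟨q, rfl | rfl⟩
      · exact (improves_sqUnits_even hπ h2 (by omega)).mono hsq
      · rintro g ⟨r, hr⟩
        have hg : (g : R) = 1 + π ^ (2 * q + 1) * r := by rw [← hr]; ring
        obtain ⟨l, rfl⟩ : ∃ l, f = q + 1 + l := ⟨f - (q + 1), by omega⟩
        obtain ⟨u, w, hu⟩ := exists_dvd_sq_sub hπ h2 (by omega) (((δ⁻¹ : Rˣ) : R) * r)
        have hδ : (δ : R) * ((δ⁻¹ : Rˣ) : R) = 1 := δ.mul_inv
        set δ' : R := ((δ⁻¹ : Rˣ) : R)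
        have hun : IsUnit (1 + π ^ (2 * q + 1) * (ε * u * π ^ (l + 1) - δ * u ^ 2)) :=
          isUnit_one_add_pow_mul hπ (by omega) _
        refine ⟨hun.unit, hnorm q u _ ?_, ?_⟩
        · rw [IsUnit.unit_spec]; ring
        · rw [Units.val_mul, IsUnit.unit_spec, hg]
          refine ⟨-δ * w + ε * u * π ^ l + π ^ (2 * q) * r * (ε * u * π ^ (l + 1) - δ * u ^ 2), ?_⟩
          linear_combination -π ^ (2 * q + 1) * δ * hu - π ^ (2 * q + 1) * r * hδ
    · rintro g ⟨r, hr⟩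
      obtain ⟨l, rfl⟩ : ∃ l, i = 2 * f + 2 + l := ⟨i - (2 * f + 2), by omega⟩
      have hg : (g : R) = 1 + π ^ (2 * f + 2 + l) * r := by rw [← hr]; ring
      have hε : (ε : R) * ((ε⁻¹ : Rˣ) : R) = 1 := ε.mul_inv
      set ε' : R := ((ε⁻¹ : Rˣ) : R)
      have hun : IsUnit (1 + π ^ (2 * f + 2 + l) * (-r - δ * (ε' * r) ^ 2 * π ^ (l + 1))) :=
        isUnit_one_add_pow_mul hπ (by omega) _
      refine ⟨hun.unit, hnorm (f + 1 + l) (-(ε' * r)) _ ?_, ?_⟩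
      · rw [IsUnit.unit_spec]
        linear_combination π ^ (2 * f + 2 + l) * r * hε
      · rw [Units.val_mul, IsUnit.unit_spec, hg]
        refine ⟨-δ * (ε' * r) ^ 2 * π ^ l
          + π ^ (2 * f + 1 + l) * r * (-r - δ * (ε' * r) ^ 2 * π ^ (l + 1)), ?_⟩
        ring
  · refine halfImproves_of_quadratic hπ (by omega) (-δ) ε.isUnit fun u => ?_
    have hun : IsUnit (1 + π ^ (2 * f + 1) * (-δ * u ^ 2 + ε * u)) :=
      isUnit_one_add_pow_mul hπ (by omega) _
    refine ⟨hun.unit, hnorm f u _ ?_, hun.unit_spec⟩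
    rw [IsUnit.unit_spec]; ring

/-- At a positive level take y = π^i r/2: then (1-y)² - αy² = 1 - π^i r - ρr²π^(2i), the 4 in α
cancelling the denominators. At level 0, use universality of binary forms over a finite field if e =
0, and squares otherwise. There is no critical level. -/
theorem mem_unitNorms_of_four_dvd {α : Rˣ} {ρ : R} (hα : (α : R) = 1 + 4 * ρ) (g : Rˣ) :
    g ∈ unitNorms R (unitsIncl R K α) := by
  have hsq := sqUnits_le_unitNorms (R := R) (unitsIncl R K α)
  have h2K : (2 : K) ≠ 0 := by
    have := congrArg (algebraMap R K) h2
    rw [map_ofNat] at this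
    rw [this, map_mul, map_pow]
    exact mul_ne_zero (unitsIncl R K ε).ne_zero (pow_ne_zero _ (uniformizer K hπ).ne_zero)
  have hαK := congrArg (algebraMap R K) hα
  simp only [map_ofNat, map_mul, map_add, map_one] at hαK
  refine mem_of_improves (π := π) (n := 0) (M := M) ?_ (fun g hg => hsq (hM g hg)) g (by simp)
  intro i _ _
  rcases Nat.eq_zero_or_pos i with rfl | hi
  · rcases Nat.eq_zero_or_pos e with rfl | he
    · intro g _
      obtain ⟨x, y, h⟩ := exists_sq_sub_mul_sq_eq (two_ne_zero_residueField h2 rfl)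
        ((residue_ne_zero_iff_isUnit (α : R)).mpr α.isUnit) (residue R ((g⁻¹ : Rˣ) : R))
      obtain ⟨x, rfl⟩ := residue_surjective x
      obtain ⟨y, rfl⟩ := residue_surjective y
      rw [← map_pow, ← map_pow, ← map_mul, ← map_sub] at h
      have hun : IsUnit (x ^ 2 - α * y ^ 2) := by
        rw [← residue_ne_zero_iff_isUnit, h, residue_ne_zero_iff_isUnit]
        exact g⁻¹.isUnit
      refine ⟨hun.unit, ⟨algebraMap R K x, algebraMap R K y, ?_⟩, ?_⟩
      · rw [coe_unitsIncl, coe_unitsIncl, IsUnit.unit_spec]; simp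
      · rw [Units.val_mul, IsUnit.unit_spec, zero_add, pow_one, ← residue_eq_iff_dvd hπ, map_mul, h,
          ← map_mul, Units.mul_inv]
    · exact (improves_sqUnits_zero hπ h2 he).mono hsq
  · obtain ⟨i, rfl⟩ : ∃ j, i = j + 1 := ⟨i - 1, by omega⟩
    rintro g ⟨r, hr⟩
    have hg : (g : R) = 1 + π ^ (i + 1) * r := by rw [← hr]; ring
    have hun : IsUnit (1 + π ^ (i + 1) * (-r - ρ * r ^ 2 * π ^ (i + 1))) :=
      isUnit_one_add_pow_mul hπ (by omega) _
    refine ⟨hun.unit, ⟨1 - algebraMap R K (π ^ (i + 1) * r) / 2,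
      algebraMap R K (π ^ (i + 1) * r) / 2, ?_⟩, ?_⟩
    · rw [coe_unitsIncl, coe_unitsIncl, IsUnit.unit_spec, hαK]
      simp only [map_add, map_mul, map_one, map_pow, map_sub, map_neg]
      field_simp
      ring
    · rw [Units.val_mul, IsUnit.unit_spec, hg]
      refine ⟨-ρ * r ^ 2 * π ^ i + π ^ i * r * (-r - ρ * r ^ 2 * π ^ (i + 1)), ?_⟩
      ring

theorem mul_mem_normGroup (a x y : Kˣ) (hx : x ∉ normGroup a) (hy : y ∉ normGroup a) :
    x * y ∈ normGroup a := by
  obtain ⟨n, u, rfl⟩ := exists_eq_unit_mul_zpow hπ a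
  rcases Int.even_or_odd' n with ⟨l, rfl | rfl⟩
  · obtain ⟨s, hs⟩ := exists_unit_normal_form hπ h2 u
    have hu : normGroup (unitsIncl R K u * uniformizer K hπ ^ (2 * l))
        = normGroup (unitsIncl R K (s ^ 2 * u)) := by
      rw [map_mul, map_pow, normGroup_sq_mul, mul_comm 2 l, zpow_mul, mul_comm]
      exact_mod_cast normGroup_sq_mul (unitsIncl R K u) (uniformizer K hπ ^ l)
    rw [hu] at hx hy ⊢
    rcases hs with ⟨ρ, hs⟩ | ⟨m, δ, hm, hs⟩
    · exact mul_mem_of_forall_unit_mem hπ (mem_unitNorms_of_four_dvd hπ h2 hM hs) x y hx hy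
    · exact mul_mem_normGroup_of_odd_defect hπ h2 hM hm hs x y hx hy
  -- For odd valuation, a is a square times the uniformizer uπ, so the uniformizer case applies with
  -- uπ in place of π.
  · have hπ' : Irreducible ((u : R) * π) := (irreducible_units_mul u).mpr hπ
    have h2' : (2 : R) = ((ε * (u⁻¹) ^ e : Rˣ) : R) * ((u : R) * π) ^ e := by
      have h1 : ((u⁻¹ : Rˣ) : R) ^ e * (u : R) ^ e = 1 := by
        rw [← mul_pow, Units.inv_mul, one_pow]
      rw [h2, Units.val_mul, Units.val_pow_eq_pow_val]
      linear_combination (-(ε : R) * π ^ e) * h1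
    have hM' : ∀ g : Rˣ, ((u : R) * π) ^ M ∣ (g : R) - 1 → g ∈ sqUnits R := fun g hg =>
      hM g ((pow_dvd_pow_of_dvd (Dvd.intro_left _ rfl) M).trans hg)
    have hu : normGroup (unitsIncl R K u * uniformizer K hπ ^ (2 * l + 1))
        = normGroup (uniformizer K hπ') := by
      have h1 : unitsIncl R K u * uniformizer K hπ ^ (2 * l + 1)
          = (uniformizer K hπ ^ l) ^ 2 * uniformizer K hπ' := by
        have : uniformizer K hπ' = unitsIncl R K u * uniformizer K hπ := by
          ext; simp [coe_uniformizer, coe_unitsIncl]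
        rw [this, zpow_add, mul_comm 2 l, zpow_mul, zpow_one]
        exact mul_left_comm _ _ _
      rw [h1, normGroup_sq_mul]
    rw [hu] at hx hy ⊢
    exact mul_mem_normGroup_uniformizer hπ' h2' hM' x y hx hy

end UnitNorms

end MilnorWitt

namespace MilnorWitt

open IsLocalRing

/-! ### The unramified norm form represents only even valuations -/

section Unramified

variable {R : Type*} [CommRing R] [IsDomain R] [IsDiscreteValuationRing R]
  {π : R} (hπ : Irreducible π) {ρ : R} (hρ : ∀ t : R, ¬π ∣ t ^ 2 + t - ρ)
include hπ hρ

theorem dvd_of_dvd_sq_add {a b : R} (h : π ∣ a ^ 2 + a * b - ρ * b ^ 2) : π ∣ a ∧ π ∣ b := by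
  have hp := hπ.prime
  by_cases hb : π ∣ b
  · refine ⟨hp.dvd_of_dvd_pow (n := 2) ?_, hb⟩
    have h1 : π ∣ a * b - ρ * b ^ 2 :=
      dvd_sub (hb.mul_left a) ((dvd_pow hb two_ne_zero).mul_left ρ)
    rw [add_sub_assoc] at h
    exact (dvd_add_left h1).mp h
  · exfalso
    have hu := (isUnit_iff_not_dvd hπ b).mpr hb
    refine hρ (a * ((hu.unit⁻¹ : Rˣ) : R)) ?_
    have h1 : b * ((hu.unit⁻¹ : Rˣ) : R) = 1 := hu.mul_val_inv
    set c : R := ((hu.unit⁻¹ : Rˣ) : R)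
    have h2 : (a * c) ^ 2 + a * c - ρ = (a ^ 2 + a * b - ρ * b ^ 2) * c ^ 2 := by
      linear_combination (-(a * c) + ρ * (b * c + 1)) * h1
    rw [h2]
    exact h.mul_right _

/-- Infinite descent: the form is anisotropic modulo π, so a value divisible by π has both arguments
divisible by π, and dividing them out lowers n by 2. -/
theorem even_of_sq_add_eq (n : ℕ) : ∀ (a b : R) (u : Rˣ),
    a ^ 2 + a * b - ρ * b ^ 2 = u * π ^ n → Even n := by
  induction n using Nat.strong_induction_on with
  | _ n ih =>
    intro a b u h
    match n, ih, h with
    | 0, _, _ => exact Even.zero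
    | n + 1, ih, h =>
      obtain ⟨⟨a, rfl⟩, b, rfl⟩ := dvd_of_dvd_sq_add hπ hρ
        (h ▸ (dvd_pow_self π n.succ_ne_zero).mul_left _ : π ∣ a ^ 2 + a * b - ρ * b ^ 2)
      have h1 : π * (π * (a ^ 2 + a * b - ρ * b ^ 2)) = π * (u * π ^ n) := by
        linear_combination h
      have h2 := mul_left_cancel₀ hπ.ne_zero h1
      match n, ih, h2 with
      | 0, _, h2 =>
        refine absurd u.isUnit ((isUnit_iff_not_dvd hπ _).not.mpr (not_not.mpr ?_))
        exact ⟨_, by simpa using h2.symm⟩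
      | n + 1, ih, h2 =>
        have h3 : π * (a ^ 2 + a * b - ρ * b ^ 2) = π * (u * π ^ n) := by
          linear_combination h2
        exact (ih n (by omega) a b u (mul_left_cancel₀ hπ.ne_zero h3)).add (by decide : Even 2)

variable {K : Type*} [Field K] [Algebra R K] [IsFractionRing R K]

theorem uniformizer_notMem_normGroup {α : Rˣ} (hα : (α : R) = 1 + 4 * ρ) :
    uniformizer K hπ ∉ normGroup (unitsIncl R K α) := by
  rintro ⟨x, y, h⟩
  obtain ⟨a, c, hc, rfl⟩ := IsFractionRing.div_surjective (A := R) x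
  obtain ⟨b, d, hd, rfl⟩ := IsFractionRing.div_surjective (A := R) y
  have hc0 : c ≠ 0 := nonZeroDivisors.ne_zero hc
  have hd0 : d ≠ 0 := nonZeroDivisors.ne_zero hd
  have hcK : algebraMap R K c ≠ 0 := by simpa using hc0
  have hdK : algebraMap R K d ≠ 0 := by simpa using hd0
  obtain ⟨n, u, hu⟩ := IsDiscreteValuationRing.eq_unit_mul_pow_irreducible (mul_ne_zero hc0 hd0) hπ
  rw [coe_uniformizer, coe_unitsIncl, hα] at h
  field_simp at h
  have h1 : π * (c * d) ^ 2 = (a * d) ^ 2 - (1 + 4 * ρ) * (b * c) ^ 2 := by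
    apply IsFractionRing.injective R K
    simp only [map_mul, map_pow, map_sub]
    linear_combination h
  rw [hu] at h1
  -- The substitution (x, y) ↦ (x - y, 2y) turns a² + ab - ρb² into x² - (1 + 4ρ)y².
  have h2 := even_of_sq_add_eq hπ hρ (2 * n + 1) (a * d - b * c) (2 * (b * c)) (u ^ 2) (by
    rw [Units.val_pow_eq_pow_val]
    linear_combination -h1)
  exact (Nat.not_even_iff_odd.mpr ⟨n, rfl⟩) h2

end Unramified

theorem exists_normIndexTwo {R : Type*} (K : Type*) [CommRing R] [IsDomain R]
    [IsDiscreteValuationRing R] [Field K] [Algebra R K] [IsFractionRing R K]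
    [Finite (ResidueField R)] (h2 : (2 : R) ≠ 0) {π : R} (hπ : Irreducible π) {M : ℕ}
    (hM : ∀ g : Rˣ, π ^ M ∣ (g : R) - 1 → g ∈ sqUnits R) :
    ∃ Δ ϖ : Kˣ, NormIndexTwo K Δ ϖ := by
  obtain ⟨e, ε, h2⟩ := IsDiscreteValuationRing.eq_unit_mul_pow_irreducible h2 hπ
  obtain ⟨ρ, hρ⟩ := exists_forall_sq_add_ne (ResidueField R)
  obtain ⟨ρ, rfl⟩ := residue_surjective ρ
  have hα : IsUnit (1 + 4 * ρ) := by
    rw [← residue_ne_zero_iff_isUnit]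
    intro h
    rw [map_add, map_mul, map_one, map_ofNat] at h
    by_cases h2' : (2 : ResidueField R) = 0
    · have h4 : (4 : ResidueField R) = 0 := by linear_combination 2 * h2'
      rw [h4, zero_mul, add_zero] at h
      exact one_ne_zero h
    -- 1 + 4ρ is the discriminant of t² + t - ρ; were it 0 with 2 invertible, -1/2 would be a double
    -- root.
    · refine hρ (-1 / 2) ?_
      field_simp
      linear_combination -h
  have hρ' (t : R) : ¬π ∣ t ^ 2 + t - ρ := by
    rw [← residue_eq_iff_dvd hπ, map_add, map_pow]
    exact hρ _
  refine ⟨unitsIncl R K hα.unit, uniformizer K hπ, ⟨mul_mem_normGroup hπ h2 hM, ?_, ?_⟩⟩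
  · exact mem_unitNorms_of_four_dvd hπ h2 hM hα.unit_spec _
  · exact uniformizer_notMem_normGroup hπ hρ' hα.unit_spec

end MilnorWitt

namespace MilnorWitt

open Topology Filter Pointwise

/-! ### Extending the topology of an open subgroup along a section -/

section CosetTopology

variable {G H A : Type*} [AddCommGroup G] [AddCommGroup H] [TopologicalSpace H]
  [IsTopologicalAddGroup H] [AddCommGroup A] [TopologicalSpace A]
  [t : TopologicalSpace G] {i : H →+ G} (ht : t = cosetTopology i)

omit [IsTopologicalAddGroup H] in
include ht in
theorem isOpen_cosetTopology {s : Set G} : IsOpen s ↔ ∀ g, IsOpen {x : H | g + i x ∈ s} := by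
  subst ht
  rw [isOpen_iSup_iff]
  rfl

variable {f : G →+ A} {e : H →+ A} (he : IsOpenEmbedding e) (hf : ∀ x, f (i x) = e x)
include ht he hf

omit [IsTopologicalAddGroup H] in
theorem continuous_of_cosetTopology [IsTopologicalAddGroup A] : Continuous f := by
  refine continuous_def.mpr fun V hV => (isOpen_cosetTopology ht).mpr fun g => ?_
  have : Continuous fun x => f g + e x := continuous_const.add he.continuous
  simpa [Set.preimage, hf] using hV.preimage this

/-- An open subset of one coset meets any other coset in the empty set, and meets the same coset,
with another base point, in a translate by an element of H. -/
theorem isOpenEmbedding_add (g : G) : IsOpenEmbedding fun x => g + i x := by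
  have hi : Function.Injective i := fun x y h => he.injective (by rw [← hf, ← hf, h])
  refine .of_continuous_injective_isOpenMap ?_ (fun x y h => hi (add_left_cancel h)) ?_
  · exact continuous_def.mpr fun V hV => (isOpen_cosetTopology ht).mp hV g
  · intro W hW
    refine (isOpen_cosetTopology ht).mpr fun g' => ?_
    by_cases hg : ∃ c, g' - g = i c
    · obtain ⟨c, hc⟩ := hg
      have : {x | g' + i x ∈ (fun x => g + i x) '' W} = (fun x => c + x) ⁻¹' W := by
        ext x
        constructor
        · rintro ⟨w, hw, h⟩
          have h : g + i w = g' + i x := h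
          have h1 : i w = i (c + x) := by
            rw [map_add, ← hc]
            exact add_left_cancel (a := g) (by rw [h]; abel)
          exact (hi h1 ▸ hw : c + x ∈ W)
        · intro h
          exact ⟨c + x, h, by simp only [map_add, ← hc]; abel⟩
      rw [this]
      exact hW.preimage (continuous_const.add continuous_id)
    · convert isOpen_empty
      refine Set.eq_empty_of_forall_notMem ?_
      rintro x ⟨w, -, h⟩
      have h : g + i w = g' + i x := h
      refine hg ⟨w - x, ?_⟩
      rw [map_sub, sub_eq_sub_iff_add_eq_add, ← h, add_comm]

theorem nhds_eq_map (g : G) : 𝓝 g = map (fun x => g + i x) (𝓝 0) := by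
  have := (isOpenEmbedding_add ht he hf g).map_nhds_eq 0
  rwa [map_zero, add_zero, eq_comm] at this

theorem isTopologicalAddGroup_of_cosetTopology : IsTopologicalAddGroup G := by
  have h0 : 𝓝 (0 : G) = map i (𝓝 0) := by
    simpa using nhds_eq_map ht he hf 0
  refine IsTopologicalAddGroup.of_comm_of_nhds_zero ?_ ?_ fun g => ?_
  · rw [h0, prod_map_map_eq, tendsto_map'_iff]
    have h1 : Tendsto (fun x : H × H => x.1 + x.2) (𝓝 0 ×ˢ 𝓝 0) (𝓝 0) := by
      have := (continuous_add (M := H)).tendsto (0, 0)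
      rwa [nhds_prod_eq, add_zero] at this
    have h2 := (tendsto_map (f := i)).comp h1
    refine h2.congr fun x => ?_
    simp [Function.uncurry]
  · rw [h0, tendsto_map'_iff]
    have h1 : Tendsto (fun x : H => -x) (𝓝 0) (𝓝 0) := by
      have := (continuous_neg (G := H)).tendsto 0
      rwa [neg_zero] at this
    refine ((tendsto_map (f := i)).comp h1).congr fun x => ?_
    simp
  · rw [nhds_eq_map ht he hf, h0, map_map]
    rfl

/-- The kernel is discrete because the open subgroup i(H) meets it only in 0. Over the open coset
f(g) + e(H) the inverse of e gives a continuous section, and translating by it identifies the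
preimage with the coset times the kernel. -/
theorem isCoveringMap_of_cosetTopology [IsTopologicalAddGroup A] (hsurj : Function.Surjective f) : IsCoveringMap f := by
  have := isTopologicalAddGroup_of_cosetTopology ht he hf
  have hcont := continuous_of_cosetTopology ht he hf
  have hi : IsOpenEmbedding i := by simpa using isOpenEmbedding_add ht he hf 0
  have hdisc : DiscreteTopology f.ker := by
    apply discreteTopology_of_isOpen_singleton_zero
    refine ⟨Set.range i, hi.isOpen_range, ?_⟩
    ext ⟨z, hz⟩
    constructor
    · rintro ⟨x, rfl⟩
      have h1 : e x = 0 := by rw [← hf]; exact hz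
      have h2 : x = 0 := he.injective (h1.trans (map_zero e).symm)
      subst h2
      exact Subtype.ext (map_zero i)
    · intro h
      rw [Set.mem_singleton_iff] at h
      exact ⟨0, by rw [map_zero]; exact (congrArg Subtype.val h).symm⟩
  intro a
  obtain ⟨g, rfl⟩ := hsurj a
  let U : Set A := {y | y - f g ∈ Set.range e}
  have hU : IsOpen U := he.isOpen_range.preimage (continuous_id.sub continuous_const)
  let σ : U → H := fun y => he.toIsEmbedding.toHomeomorph.symm ⟨y - f g, y.2⟩
  have hσc : Continuous σ := he.toIsEmbedding.toHomeomorph.symm.continuous.comp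
    (Continuous.subtype_mk (continuous_subtype_val.sub continuous_const) _)
  have hσ (y : U) : e (σ y) = y - f g :=
    congrArg Subtype.val (he.toIsEmbedding.toHomeomorph.apply_symm_apply ⟨y - f g, y.2⟩)
  have hw (w : U × f.ker) : f (g + w.2 + i (σ w.1)) = w.1 := by
    have h2 : f (w.2 : G) = 0 := w.2.2
    rw [map_add, map_add, hf, hσ, h2, add_zero, add_sub_cancel]
  refine IsEvenlyCovered.to_isEvenlyCovered_preimage (I := f.ker)
    ⟨hdisc, U, ⟨0, by simp⟩, hU, hU.preimage hcont, ?_⟩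
  refine ⟨{
    toFun z := (⟨f z, z.2⟩, ⟨z - g - i (σ ⟨f z, z.2⟩), by
      rw [AddMonoidHom.mem_ker, map_sub, map_sub, hf, hσ, sub_self]⟩)
    invFun w := ⟨g + w.2 + i (σ w.1), by
      rw [Set.mem_preimage, hw]
      exact w.1.2⟩
    left_inv z := Subtype.ext (by simp only; abel)
    right_inv w := by
      refine Prod.ext (Subtype.ext (hw w)) (Subtype.ext ?_)
      simp only [hw, Subtype.coe_eta]
      abel
    continuous_toFun := by
      have h1 : Continuous fun z : f ⁻¹' U => (⟨f z, z.2⟩ : U) :=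
        Continuous.subtype_mk (hcont.comp continuous_subtype_val) _
      exact h1.prodMk (Continuous.subtype_mk ((continuous_subtype_val.sub continuous_const).sub
        (hi.continuous.comp (hσc.comp h1))) _)
    continuous_invFun := by
      refine Continuous.subtype_mk ?_ _
      exact (continuous_const.add (continuous_subtype_val.comp continuous_snd)).add
        (hi.continuous.comp (hσc.comp continuous_fst)) }, fun _ => rfl⟩

end CosetTopology

/-! ### Properties inherited along a covering -/

section FiniteKernel

variable {G A : Type*} [AddCommGroup G] [TopologicalSpace G] [IsTopologicalAddGroup G]
  [AddCommGroup A] [TopologicalSpace A] {f : G →+ A}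

theorem isProperMap_of_finite_ker (hf : IsCoveringMap f) (hsurj : Function.Surjective f)
    (hfin : ∀ a, (f ⁻¹' {a}).Finite) : IsProperMap f := by
  rw [isProperMap_iff_isClosedMap_and_compact_fibers]
  refine ⟨hf.continuous, fun C hC => ?_, fun a => (hfin a).isCompact⟩
  rw [← (hf.isQuotientMap hsurj).isClosed_preimage]
  -- The saturation of C is a closed set plus a finite, hence compact, one; so it is closed, and f
  -- is a quotient map.
  have : f ⁻¹' (f '' C) = C + (f ⁻¹' {0}) := by
    ext z
    constructor
    · rintro ⟨c, hc, h⟩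
      exact Set.mem_add.mpr ⟨c, hc, z - c, by simp [h], by abel⟩
    · intro h
      obtain ⟨c, hc, k, hk, rfl⟩ := Set.mem_add.mp h
      have hk : f k = 0 := hk
      exact ⟨c, hc, by rw [map_add, hk, add_zero]⟩
  rw [this]
  exact hC.add_right_of_isCompact (hfin 0).isCompact

theorem locallyCompactSpace_of_isProperMap [LocallyCompactSpace A] (hf : IsProperMap f) :
    LocallyCompactSpace G := by
  obtain ⟨K, hK, h0⟩ := exists_compact_mem_nhds (0 : A)
  refine (hf.isCompact_preimage hK).locallyCompactSpace_of_mem_nhds_of_addGroup (x := 0) ?_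
  exact hf.continuous.continuousAt.preimage_mem_nhds (by rwa [map_zero])

end FiniteKernel

/-- A preconnected set maps to a point; by uniqueness of lifts its inclusion is then constant. -/
theorem totallyDisconnectedSpace_of_isCoveringMap {X Y : Type*} [TopologicalSpace X]
    [TopologicalSpace Y] [TotallyDisconnectedSpace Y] {f : X → Y} (hf : IsCoveringMap f) :
    TotallyDisconnectedSpace X := by
  refine ⟨fun s _ hs x hx y hy => ?_⟩
  refine hf.constOn_of_comp hs (g := id) continuousOn_id (fun a ha b hb => ?_) hx hy
  exact (hs.image f hf.continuous.continuousOn).subsingleton ⟨a, ha, rfl⟩ ⟨b, hb, rfl⟩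

/-! ### The topology of `K_1^MW` -/

section K1

variable {F : Type*} [Field F]

/-- The embedding `F^{×2} → K_1^MW(F)` as a homomorphism. -/
noncomputable def ofSquareHom (F : Type*) [Field F] : Additive (unitSquares F) →+ K1 F :=
  AddMonoidHom.mk' (fun c => ofSquare c.toMul) (by
    intro c d
    obtain ⟨b, hb⟩ := c.toMul.2
    refine Subtype.ext ?_
    change symb ((c.toMul : Fˣ) * (d.toMul : Fˣ)) = symb (c.toMul : Fˣ) + symb (d.toMul : Fˣ)
    rw [← hb, powMonoidHom_apply, symb_mul, eta_mul_symb_sq, zero_mul, add_zero])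

/-- The inclusion of the squares of units. -/
def squaresIncl (F : Type*) [Field F] : Additive (unitSquares F) →+ Additive Fˣ :=
  (unitSquares F).subtype.toAdditive

theorem p_ofSquareHom (c : Additive (unitSquares F)) :
    p F (ofSquareHom F c) = squaresIncl F c := p_symb _

variable [TopologicalSpace F]

theorem isOpenEmbedding_squaresIncl (h : IsOpen (unitSquares F : Set Fˣ)) :
    IsOpenEmbedding (squaresIncl F) :=
  h.isOpenEmbedding_subtypeVal

theorem topology_eq_cosetTopology :
    (inferInstance : TopologicalSpace (K1 F)) = cosetTopology (ofSquareHom F) := rfl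

variable [IsTopologicalRing F] (h : IsOpen (unitSquares F : Set Fˣ))

include h

theorem isTopologicalAddGroup_K1 : IsTopologicalAddGroup (K1 F) :=
  isTopologicalAddGroup_of_cosetTopology
    topology_eq_cosetTopology (isOpenEmbedding_squaresIncl h) p_ofSquareHom

theorem isCoveringMap_p : IsCoveringMap (p F) := by
  have h1 := isCoveringMap_of_cosetTopology (f := p F) (e := squaresIncl F) (i := ofSquareHom F)
    topology_eq_cosetTopology (isOpenEmbedding_squaresIncl h) p_ofSquareHom
  exact h1 (p_surjective F)

theorem isTopGroupCovering_p : IsTopGroupCovering (p F) where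
  isTopologicalAddGroup_source := isTopologicalAddGroup_K1 h
  isTopologicalAddGroup_target := inferInstance
  isCoveringMap := isCoveringMap_p h
  surjective := p_surjective F

end K1

end MilnorWitt

namespace MilnorWitt

open IsLocalRing Topology

/-! ### The kernel of the residue map -/

theorem isClosed_of_mem_nhds_zero {G : Type*} [AddCommGroup G] [TopologicalSpace G]
    [IsTopologicalAddGroup G] (H : AddSubgroup G) (h : (H : Set G) ∈ 𝓝 0) :
    IsClosed (H : Set G) :=
  AddSubgroup.isClosed_of_isOpen _ (AddSubgroup.isOpen_of_mem_nhds _ h)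

section Integers

/-- The rank homomorphism on Milnor–Witt K-theory, which vanishes outside degree `0`. -/
noncomputable def rank (k : Type*) [Field k] : KMW k →+ ℤ :=
  AddMonoidHom.mk' (fun x => (toMilnorTrunc k x (1, 0)).1) (by
    intro x y
    rw [map_add]
    rfl)

theorem rank_apply {k : Type*} [Field k] (x : KMW k) : rank k x = (toMilnorTrunc k x (1, 0)).1 :=
  rfl

theorem toMilnorTrunc_angle {k : Type*} [Field k] (u : kˣ) : toMilnorTrunc k (angle u) = 1 := by
  rw [angle, map_add, map_one, map_mul, toMilnorTrunc_eta, zero_mul]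
  exact add_zero (1 : AddMonoid.End (ℤ × Additive kˣ))

theorem rank_angle_mul {k : Type*} [Field k] (u : kˣ) (x : KMW k) :
    rank k (angle u * x) = rank k x := by
  rw [rank_apply, rank_apply, map_mul, toMilnorTrunc_angle, one_mul]

theorem rank_eta_mul {k : Type*} [Field k] (x : KMW k) : rank k (eta k * x) = 0 := by
  rw [rank_apply, map_mul, toMilnorTrunc_eta, zero_mul]
  rfl

theorem rank_nEps_mul_angle {k : Type*} [Field k] (n : ℤ) (u : kˣ) :
    rank k (nEps k n * angle u) = n := by
  have h1 : rank k 1 = 1 := by rw [rank_apply, map_one]; rfl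
  have h2 : rank k (hyp k) = 2 := by
    rw [hyp, map_add, rank_eta_mul, ← one_add_one_eq_two, map_add, h1]; rfl
  have h3 : ((n % 2 : ℤ) : KMW k) = (n % 2) • (1 : KMW k) := (zsmul_one _).symm
  rw [← angle_mul_nEps, rank_angle_mul, nEps, map_add, map_zsmul, h2, h3, map_zsmul, h1,
    smul_eq_mul, smul_eq_mul]
  omega

/-- The rank homomorphism on twisted Milnor–Witt K-theory. -/
noncomputable def twistRank (k V : Type*) [Field k] [AddCommGroup V] [Module k V] :
    KMWTwist k V →+ ℤ :=
  QuotientAddGroup.lift _ (Finsupp.liftAddHom fun _ => rank k) (by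
    refine (AddSubgroup.closure_le _).mpr ?_
    rintro _ ⟨u, f, g, x, -, rfl⟩
    rw [SetLike.mem_coe, AddMonoidHom.mem_ker, map_sub, Finsupp.liftAddHom_apply_single,
      Finsupp.liftAddHom_apply_single, rank_angle_mul, sub_self])

theorem twistRank_tmul {k V : Type*} [Field k] [AddCommGroup V] [Module k V]
    (f : {f : V // f ≠ 0}) (x : KMW k) : twistRank k V (KMWTwist.tmul f x) = rank k x :=
  Finsupp.liftAddHom_apply_single (fun _ => rank k) f x

variable {R K : Type*} [CommRing R] [IsDomain R] [IsDiscreteValuationRing R] [Field K]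
  [Algebra R K] [IsFractionRing R K] {π : R} (hπ : Irreducible π)

theorem residueMap_symb (a : Kˣ) :
    residueMap K hπ (symb a) = nEps _ (ordNum hπ a) * angle (unitResidue (unitPart hπ a)) := by
  have h : residueHom K hπ (symb a) = residueSymb hπ a := by exact lift_symb ..
  change residueHom K hπ (symb a) 1 0 = _
  rw [h]
  rfl

theorem residueMap_eta_mul (x : KMW K) :
    residueMap K hπ (eta K * x) = eta _ * residueMap K hπ x := by
  have h : residueHom K hπ (eta K) = !![eta (ResidueField R), 0; 0, eta (ResidueField R)] := by
    exact lift_eta ..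
  change residueHom K hπ (eta K * x) 1 0 = _ * residueHom K hπ x 1 0
  rw [map_mul, h, Matrix.mul_apply, Fin.sum_univ_two]
  simp

theorem ordNum_unit_mul_zpow {u : Rˣ} {n : ℤ} {x : Kˣ}
    (h : (x : K) = algebraMap R K (u : R) * algebraMap R K π ^ n) : ordNum hπ x = n :=
  (decomposition_unique hπ h).1

/-- The normalized valuation as a homomorphism. -/
noncomputable def ordHom (K : Type*) [Field K] [Algebra R K] [IsFractionRing R K]
    (hπ : Irreducible π) : Additive Kˣ →+ ℤ :=
  AddMonoidHom.mk' (fun x => ordNum hπ x.toMul) fun x y => (ordNum_mul hπ x.toMul y.toMul).1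

/-- On [a] the residue is n_ε⟨ū⟩, of rank n = ord(a), while multiples of η have residue of rank 0
and trivial image under `p`. Hence a vanishing residue forces p(z) to be a unit. -/
theorem rank_residueMap (x : KMW K) (hx : x ∈ degreePart K 1) :
    rank _ (residueMap K hπ x) = ordHom K hπ (toMilnorTrunc K x (1, 0)).2 := by
  induction hx using AddSubgroup.closure_induction with
  | mem x hx =>
    obtain ⟨m, l, hl, rfl⟩ := hx
    cases m with
    | zero =>
      obtain ⟨a, rfl⟩ := List.length_eq_one_iff.mp (by simpa using hl : l.length = 1)
      rw [pow_zero, one_mul, List.map_singleton, List.prod_singleton, residueMap_symb,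
        rank_nEps_mul_angle, toMilnorTrunc_symb, truncSymb_apply, one_smul]
      rfl
    | succ m =>
      rw [pow_succ', mul_assoc, residueMap_eta_mul, rank_eta_mul, map_mul, toMilnorTrunc_eta,
        zero_mul]
      exact (map_zero (ordHom K hπ)).symm
  | zero =>
    rw [map_zero, map_zero, map_zero]
    exact (map_zero (ordHom K hπ)).symm
  | add x y _ _ hx hy =>
    rw [map_add, map_add, hx, hy, map_add, ← map_add]
    rfl
  | neg x _ hx =>
    rw [map_neg, map_neg, hx, map_neg, ← map_neg]
    rfl

theorem ordHom_p_eq_zero {z : K1 K} (hz : z ∈ K1Integers K hπ) : ordHom K hπ (p K z) = 0 := by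
  have h0 : twistedResidue K hπ (K1.incl K z) = 0 := hz
  have h1 := rank_residueMap hπ (K1.incl K z) z.2
  rw [p_apply, ← h1, ← twistRank_tmul (dualUniformizer hπ)]
  exact (congrArg _ h0).trans (map_zero _)

theorem symb_mem_K1Integers {a : Kˣ} (ha : ordNum hπ a = 0) : K1.symb a ∈ K1Integers K hπ := by
  change KMWTwist.tmul _ (residueMap K hπ (symb a)) = 0
  rw [residueMap_symb, ha, nEps_zero, zero_mul, map_zero]

variable [TopologicalSpace K] [IsTopologicalRing K]

theorem K1Integers_mem_nhds_zero (hsq : IsOpen (unitSquares K : Set Kˣ))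
    (hopen : IsOpen {x : Kˣ | ordNum hπ x = 0}) :
    (K1Integers K hπ : Set (K1 K)) ∈ 𝓝 0 := by
  have h0 := nhds_eq_map (f := p K) (e := squaresIncl K) (i := ofSquareHom K)
    topology_eq_cosetTopology (isOpenEmbedding_squaresIncl hsq) p_ofSquareHom 0
  rw [h0]
  refine Filter.mem_map.mpr ?_
  have h1 : IsOpen (squaresIncl K ⁻¹' {x : Additive Kˣ | ordNum hπ x.toMul = 0}) :=
    IsOpen.preimage (isOpenEmbedding_squaresIncl hsq).continuous hopen
  refine Filter.mem_of_superset (h1.mem_nhds ?_) fun c hc => ?_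
  · exact map_zero (ordHom K hπ)
  · change 0 + ofSquareHom K c ∈ K1Integers K hπ
    rw [zero_add]
    exact symb_mem_K1Integers hπ hc

/-- Only containment in the preimage of the units is needed: the kernel is a subgroup and a
neighbourhood of 0, as it contains the symbols of squares of valuation 0, so it is closed in that
compact preimage. -/
theorem isCompact_K1Integers (hsq : IsOpen (unitSquares K : Set Kˣ)) (hp : IsProperMap (p K))
    (hopen : IsOpen {x : Kˣ | ordNum hπ x = 0}) (hcomp : IsCompact {x : Kˣ | ordNum hπ x = 0}) :
    IsCompact (K1Integers K hπ : Set (K1 K)) := by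
  have hgrp := isTopologicalAddGroup_K1 hsq
  have hcl := isClosed_of_mem_nhds_zero _ (K1Integers_mem_nhds_zero hπ hsq hopen)
  have hc : IsCompact (p K ⁻¹' {x : Additive Kˣ | ordNum hπ x.toMul = 0}) :=
    hp.isCompact_preimage hcomp
  exact hc.of_isClosed_subset hcl fun z hz => ordHom_p_eq_zero hπ hz

end Integers

end MilnorWitt

namespace MilnorWitt

open IsLocalRing Topology

/-! ### Completions of number fields -/

/-- Inverse function theorem for x ↦ x² at 1, where the derivative is 2. The element of norm
different from 1 makes the norm nontrivial. -/
theorem mem_nhds_isSquare (K : Type*) [NormedField K] [CompleteSpace K]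
    (h : ∃ x : K, x ≠ 0 ∧ ‖x‖ ≠ 1) (h2 : (2 : K) ≠ 0) : {x : K | IsSquare x} ∈ 𝓝 1 := by
  let _ : NontriviallyNormedField K := .ofNormNeOne h
  have h : HasStrictDerivAt (fun x : K => x ^ 2) 2 1 := by
    simpa using hasStrictDerivAt_pow 2 (1 : K)
  have h1 := h.map_nhds_eq h2
  rw [one_pow] at h1
  rw [← h1]
  exact Filter.mem_map.mpr (Filter.univ_mem' fun x => ⟨x, pow_two x⟩)

theorem isOpen_unitSquares {K : Type*} [Field K] [TopologicalSpace K] [IsTopologicalRing K]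
    (h : {x : K | IsSquare x} ∈ 𝓝 1) : IsOpen (unitSquares K : Set Kˣ) := by
  refine Subgroup.isOpen_of_mem_nhds _ (g := 1) ?_
  have h1 : (Units.val : Kˣ → K) ⁻¹' {x : K | IsSquare x} ∈ 𝓝 1 :=
    Units.continuous_val.continuousAt.preimage_mem_nhds (by simpa using h)
  refine Filter.mem_of_superset h1 ?_
  rintro x ⟨y, hy⟩
  have hy0 : y ≠ 0 := by rintro rfl; simp at hy
  exact ⟨Units.mk0 y hy0, by ext; simp [hy, pow_two]⟩

theorem totallyDisconnectedSpace_units (K : Type*) [Monoid K] [TopologicalSpace K]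
    [TotallyDisconnectedSpace K] : TotallyDisconnectedSpace Kˣ where
  isTotallyDisconnected_univ := isTotallyDisconnected_of_image
    Units.continuous_val.continuousOn Units.val_injective
    (isTotallyDisconnected_of_totallyDisconnectedSpace _)

theorem isSquare_mem_nhds_of_infinitePlace {F : Type*} [Field F] [NumberField F]
    (v : InfinitePlace F) : {x : v.Completion | IsSquare x} ∈ 𝓝 1 := by
  have h2 : ‖(2 : v.Completion)‖ = 2 := by
    have h := InfinitePlace.Completion.norm_coe v ((WithAbs.equiv v.1).symm 2)
    have h3 : (((WithAbs.equiv v.1).symm 2 : WithAbs v.1) : v.Completion) = 2 :=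
      map_ofNat (algebraMap F v.Completion) 2
    rw [h3] at h
    rw [h, RingEquiv.apply_symm_apply]
    exact_mod_cast v.map_natCast 2
  have h0 : (2 : v.Completion) ≠ 0 := by
    intro h
    rw [h, norm_zero] at h2
    norm_num at h2
  exact mem_nhds_isSquare _ ⟨2, h0, by rw [h2]; norm_num⟩ h0

/-! ### Finite places: residue field, compactness and unit squares -/

section FinitePlace

variable {F : Type*} [Field F] [NumberField F] (v : HeightOneSpectrum (𝓞 F))

open HeightOneSpectrum

theorem residue_eq_of_valued_sub_lt_one (x y : v.adicCompletionIntegers F)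
    (h : Valued.v ((x : v.adicCompletion F) - y) < 1) :
    residue (v.adicCompletionIntegers F) x = residue (v.adicCompletionIntegers F) y := by
  rw [← sub_eq_zero, ← map_sub, residue_eq_zero_iff, mem_maximalIdeal, mem_nonunits_iff,
    adicCompletionIntegers.isUnit_iff_valued_eq_one]
  exact h.ne

/-- Approximate twice: by an element of F by density, which is then v-integral, and next by an
element of 𝓞 F. Both errors have valuation less than 1. -/
theorem surjective_residue_comp_algebraMap : Function.Surjective
    ((residue (v.adicCompletionIntegers F)).comp
      (algebraMap (𝓞 F) (v.adicCompletionIntegers F))) := by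
  intro r
  obtain ⟨x, rfl⟩ := residue_surjective r
  obtain ⟨k, hk⟩ := (v.denseRange_algebraMap F).exists_dist_lt (x : v.adicCompletion F) one_pos
  rw [dist_eq_norm, Valued.toNormedField.norm_lt_one_iff] at hk
  have hk1 : v.valuation F k ≤ 1 := by
    rw [← valuedAdicCompletion_eq_valuation']
    have h : (algebraMap F (v.adicCompletion F) k)
        = (x : v.adicCompletion F) - (x - algebraMap F (v.adicCompletion F) k) := by ring
    have h1 := Valuation.map_sub_le (v := (Valued.v : Valuation (v.adicCompletion F) _))
      x.2 hk.le
    rw [← h] at h1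
    exact h1
  obtain ⟨a, ha⟩ := v.exists_valuation_sub_lt_of_integer hk1 1
  refine ⟨a, residue_eq_of_valued_sub_lt_one v _ _ ?_⟩
  rw [← valuedAdicCompletion_eq_valuation', Units.val_one] at ha
  have hsplit : ((algebraMap (𝓞 F) (v.adicCompletionIntegers F) a : v.adicCompletionIntegers F) :
      v.adicCompletion F) - x = algebraMap F (v.adicCompletion F) (algebraMap (𝓞 F) F a - k)
        - (x - algebraMap F (v.adicCompletion F) k) := by
    rw [map_sub, sub_sub_sub_cancel_right]
    rfl
  rw [hsplit]
  exact Valuation.map_sub_lt _ ha hk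

instance : Finite (ResidueField (v.adicCompletionIntegers F)) := by
  have hfin := v.asIdeal.finiteQuotientOfFreeOfNeBot v.ne_bot
  have hker : ∀ a ∈ v.asIdeal, (residue (v.adicCompletionIntegers F)).comp
      (algebraMap (𝓞 F) (v.adicCompletionIntegers F)) a = 0 := by
    intro a ha
    rw [← valuation_lt_one_iff_mem (K := F), ← valuedAdicCompletion_eq_valuation] at ha
    rw [RingHom.comp_apply, ← map_zero (residue (v.adicCompletionIntegers F))]
    refine residue_eq_of_valued_sub_lt_one v _ _ ?_
    rw [ZeroMemClass.coe_zero, sub_zero]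
    exact ha
  refine Finite.of_surjective (Ideal.Quotient.lift v.asIdeal _ hker) ?_
  exact Ideal.Quotient.lift_surjective_of_surjective _ hker (surjective_residue_comp_algebraMap v)

theorem isClosed_adicCompletionIntegers :
    IsClosed (v.adicCompletionIntegers F : Set (v.adicCompletion F)) :=
  Valued.isClosed_valuationSubring _

instance : CompactSpace (v.adicCompletionIntegers F) := by
  have h1 : CompleteSpace (v.adicCompletionIntegers F) :=
    (isClosed_adicCompletionIntegers v).completeSpace_coe
  exact Valued.integer.compactSpace_iff_completeSpace_and_isDiscreteValuationRing_and_finite_residueField.mpr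
    ⟨h1, inferInstanceAs (IsDiscreteValuationRing (v.adicCompletionIntegers F)),
      inferInstanceAs (Finite (ResidueField (v.adicCompletionIntegers F)))⟩

instance : LocallyCompactSpace (v.adicCompletion F) := by
  have h : IsCompact (v.adicCompletionIntegers F : Set (v.adicCompletion F)) :=
    isCompact_iff_compactSpace.mpr (inferInstanceAs (CompactSpace (v.adicCompletionIntegers F)))
  exact h.locallyCompactSpace_of_mem_nhds_of_addGroup (x := 0)
    ((Valued.isOpen_valuationSubring _).mem_nhds (zero_mem (v.adicCompletionIntegers F)))

theorem two_ne_zero_adicCompletion : (2 : v.adicCompletion F) ≠ 0 := by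
  rw [← map_ofNat (algebraMap F (v.adicCompletion F)) 2]
  exact (map_ne_zero _).mpr two_ne_zero

instance : NeZero (2 : v.adicCompletion F) := ⟨two_ne_zero_adicCompletion v⟩

theorem norm_lt_one_of_irreducible {π : v.adicCompletionIntegers F} (hπ : Irreducible π) :
    ‖(π : v.adicCompletion F)‖ < 1 := by
  rw [Valued.toNormedField.norm_lt_one_iff]
  have h := adicCompletionIntegers.isUnit_iff_valued_eq_one.not.mp hπ.not_isUnit
  exact lt_of_le_of_ne π.2 h

theorem isSquare_mem_nhds_of_finitePlace :
    {x : v.adicCompletion F | IsSquare x} ∈ 𝓝 1 := by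
  obtain ⟨π, hπ⟩ := IsDiscreteValuationRing.exists_irreducible (v.adicCompletionIntegers F)
  exact mem_nhds_isSquare _ ⟨π, by simpa using hπ.ne_zero, (norm_lt_one_of_irreducible v hπ).ne⟩
    (two_ne_zero_adicCompletion v)

/-- This is the terminal level of the filtration arguments: units close enough to 1 lie in the
neighbourhood consisting of squares, and the square root of a unit has valuation 1, so it is itself
a unit. -/
theorem exists_pow_dvd_imp_mem_sqUnits {π : v.adicCompletionIntegers F} (hπ : Irreducible π) :
    ∃ M : ℕ, ∀ g : (v.adicCompletionIntegers F)ˣ, π ^ M ∣ (g : v.adicCompletionIntegers F) - 1 →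
      g ∈ sqUnits (v.adicCompletionIntegers F) := by
  obtain ⟨δ, hδ, hball⟩ := Metric.mem_nhds_iff.mp (isSquare_mem_nhds_of_finitePlace v)
  obtain ⟨M, hM⟩ := exists_pow_lt_of_lt_one hδ (norm_lt_one_of_irreducible v hπ)
  refine ⟨M, ?_⟩
  rintro g ⟨r, hr⟩
  have hr' := congrArg (Subtype.val : _ → v.adicCompletion F) hr
  simp only [AddSubgroupClass.coe_sub, OneMemClass.coe_one, MulMemClass.coe_mul,
    SubmonoidClass.coe_pow] at hr'
  obtain ⟨y, hy⟩ := hball (show ((g : v.adicCompletionIntegers F) : v.adicCompletion F)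
      ∈ Metric.ball 1 δ by
    rw [mem_ball_iff_norm, hr', norm_mul, norm_pow]
    refine lt_of_le_of_lt ?_ hM
    exact mul_le_of_le_one_right (by positivity) (Valued.toNormedField.norm_le_one_iff.mpr r.2))
  have hg := adicCompletionIntegers.isUnit_iff_valued_eq_one.mp g.isUnit
  rw [hy, map_mul, ← pow_two] at hg
  have hy1 : Valued.v y = 1 := (pow_eq_one_iff_of_nonneg zero_le two_ne_zero).mp hg
  have hu : IsUnit (⟨y, hy1.le⟩ : v.adicCompletionIntegers F) :=
    adicCompletionIntegers.isUnit_iff_valued_eq_one.mpr hy1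
  refine ⟨hu.unit, Units.ext (Subtype.ext ?_)⟩
  rw [hy, ← pow_two]
  rfl

theorem exists_normIndexTwo_adicCompletion :
    ∃ Δ ϖ : (v.adicCompletion F)ˣ, NormIndexTwo (v.adicCompletion F) Δ ϖ := by
  obtain ⟨π, hπ⟩ := IsDiscreteValuationRing.exists_irreducible (v.adicCompletionIntegers F)
  obtain ⟨M, hM⟩ := exists_pow_dvd_imp_mem_sqUnits v hπ
  refine exists_normIndexTwo (v.adicCompletion F) ?_ hπ hM
  intro h
  exact two_ne_zero_adicCompletion v (congrArg Subtype.val h)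

theorem ordNum_eq_zero_iff {π : v.adicCompletionIntegers F} (hπ : Irreducible π)
    (x : (v.adicCompletion F)ˣ) : ordNum hπ x = 0 ↔ x ∈ (v.adicCompletionIntegers F).units := by
  rw [adicCompletionIntegers.mem_units_iff_valued_eq_one]
  constructor
  · intro h
    rw [decomposition hπ x, h, zpow_zero, mul_one]
    exact adicCompletionIntegers.isUnit_iff_valued_eq_one.mp (unitPart hπ x).isUnit
  · intro h
    have hu : IsUnit (⟨x, h.le⟩ : v.adicCompletionIntegers F) :=
      adicCompletionIntegers.isUnit_iff_valued_eq_one.mpr h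
    refine ordNum_unit_mul_zpow hπ (u := hu.unit) ?_
    rw [zpow_zero, mul_one]
    rfl

theorem setOf_ordNum_eq_zero {π : v.adicCompletionIntegers F} (hπ : Irreducible π) :
    {x : (v.adicCompletion F)ˣ | ordNum hπ x = 0}
      = ((v.adicCompletionIntegers F).units : Set (v.adicCompletion F)ˣ) :=
  Set.ext (ordNum_eq_zero_iff v hπ)

theorem isCompact_setOf_ordNum_eq_zero {π : v.adicCompletionIntegers F} (hπ : Irreducible π) :
    IsCompact {x : (v.adicCompletion F)ˣ | ordNum hπ x = 0} := by
  rw [setOf_ordNum_eq_zero]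
  exact Submonoid.units_isCompact (isCompact_iff_compactSpace.mpr
    (inferInstanceAs (CompactSpace (v.adicCompletionIntegers F))))

theorem isOpen_setOf_ordNum_eq_zero {π : v.adicCompletionIntegers F} (hπ : Irreducible π) :
    IsOpen {x : (v.adicCompletion F)ˣ | ordNum hπ x = 0} := by
  rw [setOf_ordNum_eq_zero]
  have h := Valued.isOpen_valuationSubring (v.adicCompletion F)
  exact (h.preimage Units.continuous_val).inter
    (h.preimage (Units.continuous_val.comp continuous_inv))

end FinitePlace

end MilnorWitt

/-! ### Infinite and finite places together -/

open MilnorWitt in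
theorem proposition3p1 (F : Type*) [Field F] [NumberField F] :
    (∀ v : InfinitePlace F, IsTopGroupCovering (p v.Completion)) ∧
    ∀ v : HeightOneSpectrum (𝓞 F),
      IsTopGroupCovering (p (v.adicCompletion F)) ∧
      IsProperMap (p (v.adicCompletion F)) ∧
      (∀ x : Additive (v.adicCompletion F)ˣ, Nat.card (p (v.adicCompletion F) ⁻¹' {x}) = 2) ∧
      LocallyCompactSpace (K1 (v.adicCompletion F)) ∧
      TotallyDisconnectedSpace (K1 (v.adicCompletion F)) ∧
      ∀ (π : v.adicCompletionIntegers F) (hπ : Irreducible π),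
        IsCompact (K1Integers (v.adicCompletion F) hπ : Set (K1 (v.adicCompletion F))) := by
  refine ⟨fun v => isTopGroupCovering_p (isOpen_unitSquares (isSquare_mem_nhds_of_infinitePlace v)),
    fun v => ?_⟩
  have hsq := isOpen_unitSquares (isSquare_mem_nhds_of_finitePlace v)
  have hcov := isCoveringMap_p hsq
  have hgrp := isTopologicalAddGroup_K1 hsq
  obtain ⟨Δ, ϖ, h⟩ := exists_normIndexTwo_adicCompletion v
  have hproper : IsProperMap (p (v.adicCompletion F)) :=
    isProperMap_of_finite_ker hcov (p_surjective _) fun a =>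
      Set.finite_coe_iff.mp (Nat.finite_of_card_ne_zero (by rw [h.card_fiber]; norm_num))
  have htd : TotallyDisconnectedSpace (Additive (v.adicCompletion F)ˣ) :=
    totallyDisconnectedSpace_units (v.adicCompletion F)
  exact ⟨isTopGroupCovering_p hsq, hproper, h.card_fiber,
    locallyCompactSpace_of_isProperMap hproper, totallyDisconnectedSpace_of_isCoveringMap hcov,
    fun π hπ => isCompact_K1Integers hπ hsq hproper (isOpen_setOf_ordNum_eq_zero v hπ)
      (isCompact_setOf_ordNum_eq_zero v hπ)⟩
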